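/- A convex body is a non-empty compact convex subset $K$ of some $\mathbb{R}^n$. Let $B^n$ be the closed unit ball centred at the origin of $\mathbb{R}^n$ and $\kappa_m$ the volume of $B^m$ (so $\kappa_0=1$). The intrinsic area $V_2(K)$ of a convex body $K\subset\mathbb{R}^n$ ($n\ge 2$) is the coefficient of index $i=2$ in the Steiner formula $\operatorname{vol}_n(K+\varepsilon B^n)=\sum_{i=0}^n\varepsilon^{n-i}\kappa_{n-i}V_i(K)$, $\varepsilon>0$, and $V_2(K,L)=\frac12\left(V_2(K+L)-V_2(K)-V_2(L)\right)$ is the mixed area. Let $\mathcal{K}^{n*}$ be the set of convex bodies $K\subset\mathbb{R}^n$ with $V_2(K)>0$. For $K\in\mathcal{K}^{n*}$ let $[K]$ (the oriented shape) be its class modulo translations and positive homotheties, and let $\mathrm{OShape}^{n*}$ be the set of these classes, with the distance $$d_{OS^n}([K],[L])=\operatorname{argch}\left(\frac{V_2(K,L)}{\sqrt{V_2(K)\,V_2(L)}}\right).$$ Let $\mathrm{Shape}^{n*}$ be the quotient of $\mathrm{OShape}^{n*}$ by the action $\Phi[K]=[\Phi K]$ of $O(n)$, with the distance $d_{S^n}(\llbracket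 K\rrbracket,\llbracket L\rrbracket)=\inf_{\Phi,\Psi\in O(n)}d_{OS^n}(\Phi[K],\Psi[L])$, where $\llbracket K\rrbracket$ is the class of $[K]$. For $i\le p$ the inclusion $\mathbb{R}^i\simeq\mathbb{R}^i\times\{0\}\subset\mathbb{R}^p$ induces maps between these spaces. Let $\mathrm{OShape}^{\infty*}$ (resp. $\mathrm{Shape}^{\infty*}$) be the disjoint union over $n\geq 2$ of the spaces $\mathrm{OShape}^{n*}$ (resp. $\mathrm{Shape}^{n*}$), in which an element in dimension $i$ and an element in dimension $j$ are identified whenever they have the same image in some dimension $p\ge i,j$. The distance $d_{OS^\infty}$ (resp. $d_{S^\infty}$) between two elements is the distance $d_{OS^n}$ (resp. $d_{S^n}$) of representatives of them in a common dimension $n$ (to be read as the infimum over all such representatives and all such $n$). Write $[K]_\infty$ and $\llbracket K\rrbracket_\infty$ for the classes of $[K]$ and $\llbracket K\rrbracket$. **Proposition.** The space $(\mathrm{OShape}^{\infty*},d_{OS^\infty})$ is not complete: the sequence of balls $([B^n]_\infty)_{n\ge 2}$ is a Cauchy sequence with no limit. Likewise, $(\mathrm{Shape}^{\infty*},d_{S^\infty})$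 is not complete: the sequence $(\llbracket B^n\rrbracket_\infty)_{n\ge 2}$ is a Cauchy sequence with no limit. -/

import Mathlib

open MeasureTheory Filter Topology
open scoped Pointwise

noncomputable section

namespace Shapes

/-- Euclidean `n`-space. -/
abbrev E (n : ℕ) : Type := EuclideanSpace ℝ (Fin n)

/-! ### Intrinsic volumes and the intrinsic area -/

/-- The closed unit ball `B^n` centred at the origin. -/
def unitBall (n : ℕ) : ConvexBody (E n) where
  carrier := Metric.closedBall 0 1
  convex' := convex_closedBall 0 1
  isCompact' := isCompact_closedBall 0 1
  nonempty' := ⟨0, by simp⟩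

/-- `κ_m`, the volume of the unit ball of `ℝ^m`. -/
def kappa (m : ℕ) : ℝ := volume.real (unitBall m : Set (E m))

/-- `V 0, …, V n` are the coefficients of the Steiner formula
`vol_n (K + ε B^n) = ∑_{i ≤ n} ε^(n-i) κ_(n-i) V_i` of `K ⊆ ℝ^n`; there are no others, so `V i`
is set to `0` for `i > n`. -/
def IsSteinerCoeff {n : ℕ} (K : ConvexBody (E n)) (V : ℕ → ℝ) : Prop :=
  (∀ i, n < i → V i = 0) ∧
  ∀ ε : ℝ, 0 < ε →
    volume.real ((K + ε • unitBall n : ConvexBody (E n)) : Set (E n)) =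
      ∑ i ∈ Finset.range (n + 1), ε ^ (n - i) * kappa (n - i) * V i

open Classical in
/-- The intrinsic volume `V_i(K)`: the coefficient of index `i` in the Steiner formula of `K`.
(The coefficients are unique, see `IsSteinerCoeff.unique`.) -/
def intrinsicVolume (i : ℕ) {n : ℕ} (K : ConvexBody (E n)) : ℝ :=
  if h : ∃ V, IsSteinerCoeff K V then h.choose i else 0

/-- The intrinsic area `V_2(K)`. -/
def area {n : ℕ} (K : ConvexBody (E n)) : ℝ := intrinsicVolume 2 K

/-- The mixed area `V_2(K, L)`, obtained by polarization. -/
def mixedArea {n : ℕ} (K L : ConvexBody (E n)) : ℝ :=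
  (area (K + L) - area K - area L) / 2

/-- `argch (V_2(K,L) / √(V_2(K) V_2(L)))`, for bodies of positive area. -/
def areaDist {n : ℕ} (K L : ConvexBody (E n)) : ℝ :=
  Real.arcosh (mixedArea K L / √(area K * area L))

theorem kappa_pos (m : ℕ) : 0 < kappa m := by
  unfold kappa Measure.real
  refine ENNReal.toReal_pos (Metric.measure_closedBall_pos volume 0 one_pos).ne' ?_
  exact (unitBall m).isCompact.measure_lt_top.ne

theorem IsSteinerCoeff.unique {n : ℕ} {K : ConvexBody (E n)} {V W : ℕ → ℝ}
    (hV : IsSteinerCoeff K V) (hW : IsSteinerCoeff K W) : V = W := by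
  let P : (ℕ → ℝ) → Polynomial ℝ := fun U => ∑ i ∈ Finset.range (n + 1),
    Polynomial.monomial (n - i) (kappa (n - i) * U i)
  have hP : ∀ U ε, (P U).eval ε =
      ∑ i ∈ Finset.range (n + 1), ε ^ (n - i) * kappa (n - i) * U i := by
    intro U ε
    simp only [P, Polynomial.eval_finsetSum, Polynomial.eval_monomial]
    exact Finset.sum_congr rfl fun i _ => by ring
  have heq : P V = P W := by
    refine Polynomial.eq_of_infinite_eval_eq _ _ ((Set.Ioi_infinite (0 : ℝ)).mono ?_)
    intro ε hε
    simp only [Set.mem_ofPred_eq, hP]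
    rw [← hV.2 ε hε, ← hW.2 ε hε]
  have hc : ∀ U : ℕ → ℝ, ∀ i ≤ n, (P U).coeff (n - i) = kappa (n - i) * U i := by
    intro U i hi
    simp only [P, Polynomial.finsetSum_coeff, Polynomial.coeff_monomial]
    rw [Finset.sum_eq_single i]
    · simp
    · intro j hj hji
      have := Finset.mem_range.1 hj
      rw [if_neg (by omega)]
    · intro h
      exact absurd (Finset.mem_range.2 (by omega)) h
  funext i
  by_cases hi : i ≤ n
  · have h := hc V i hi
    rw [heq, hc W i hi] at h
    exact (mul_left_cancel₀ (kappa_pos _).ne' h).symm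
  · rw [hV.1 i (by omega), hW.1 i (by omega)]

theorem IsSteinerCoeff.intrinsicVolume_eq {n : ℕ} {K : ConvexBody (E n)} {V : ℕ → ℝ}
    (hV : IsSteinerCoeff K V) (i : ℕ) : intrinsicVolume i K = V i := by
  have h : ∃ V, IsSteinerCoeff K V := ⟨V, hV⟩
  rw [intrinsicVolume, dif_pos h, h.choose_spec.unique hV]

theorem isSteinerCoeff_unitBall (n : ℕ) : IsSteinerCoeff (unitBall n)
    (fun i => n.choose i * kappa n / kappa (n - i)) := by
  refine ⟨fun i hi => by simp [Nat.choose_eq_zero_of_lt hi], fun ε hε => ?_⟩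
  have h1 : ((unitBall n + ε • unitBall n : ConvexBody (E n)) : Set (E n)) =
      (1 + ε) • (unitBall n : Set (E n)) := by
    rw [ConvexBody.coe_add, ConvexBody.coe_smul,
      (unitBall n).convex.add_smul zero_le_one hε.le, one_smul]
  rw [h1, Measure.real, Measure.addHaar_smul_of_nonneg volume (by positivity), ENNReal.toReal_mul,
    ENNReal.toReal_ofReal (by positivity), finrank_euclideanSpace_fin]
  change (1 + ε) ^ n * kappa n = _
  rw [add_pow, Finset.sum_mul]
  refine Finset.sum_congr rfl fun i _ => ?_
  have := (kappa_pos (n - i)).ne'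
  field_simp
  simp

theorem area_unitBall_pos {n : ℕ} (hn : 2 ≤ n) : 0 < area (unitBall n) := by
  rw [area, (isSteinerCoeff_unitBall n).intrinsicVolume_eq]
  have := Nat.choose_pos hn
  have := kappa_pos n
  have := kappa_pos (n - 2)
  positivity

/-! ### Images of convex bodies, the canonical embeddings -/

/-- The image of a convex body under a linear isometric map. -/
def mapBody {m n : ℕ} (f : E m →ₗᵢ[ℝ] E n) (K : ConvexBody (E m)) : ConvexBody (E n) where
  carrier := f '' K
  convex' := K.convex.linear_image f.toLinearMap
  isCompact' := K.isCompact.image f.continuous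
  nonempty' := K.nonempty.image f

theorem mapBody_comp {l m n : ℕ} (g : E m →ₗᵢ[ℝ] E n) (f : E l →ₗᵢ[ℝ] E m)
    (K : ConvexBody (E l)) : mapBody g (mapBody f K) = mapBody (g.comp f) K :=
  ConvexBody.ext (Set.image_image _ _ _)

/-- The canonical embedding `ℝ^m ≃ ℝ^m × {0} ⊆ ℝ^n`, for `m ≤ n`. -/
def incl {m n : ℕ} (h : m ≤ n) : E m →ₗᵢ[ℝ] E n where
  toFun x := WithLp.toLp 2 fun k => if hk : (k : ℕ) < m then x ⟨k, hk⟩ else 0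
  map_add' x y := by
    ext k
    by_cases hk : (k : ℕ) < m <;> simp [hk]
  map_smul' c x := by
    ext k
    by_cases hk : (k : ℕ) < m <;> simp [hk]
  norm_map' x := by
    obtain ⟨p, rfl⟩ := Nat.exists_eq_add_of_le h
    simp [EuclideanSpace.norm_eq, Fin.sum_univ_add]

theorem incl_comp {l m n : ℕ} (h : l ≤ m) (h' : m ≤ n) :
    (incl h').comp (incl h) = incl (h.trans h') := by
  ext x k
  by_cases hk : (k : ℕ) < l
  · simp [incl, hk, hk.trans_le h]
  · simp [incl, hk]

/-- Every linear isometry of `ℝ^m` extends to one of `ℝ^n`. -/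
theorem exists_extension {m n : ℕ} (h : m ≤ n) (Φ : E m ≃ₗᵢ[ℝ] E m) :
    ∃ Ψ : E n ≃ₗᵢ[ℝ] E n,
      Ψ.toLinearIsometry.comp (incl h) = (incl h).comp Φ.toLinearIsometry := by
  let L := ((incl h).comp Φ.toLinearIsometry).comp
    (incl h).equivRange.symm.toLinearIsometry
  refine ⟨L.extend.toLinearIsometryEquiv rfl, ?_⟩
  ext1 x
  have h1 := L.extend_apply ((incl h).equivRange x)
  have h2 : (((incl h).equivRange x : LinearMap.range (incl h).toLinearMap) : E n) =
    incl h x := rfl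
  rw [h2] at h1
  change L.extend (incl h x) = incl h (Φ x)
  rw [h1]
  simp [L]

/-! ### Oriented shapes -/

/-- Convex bodies are identified when they differ by a translation and a positive homothety. -/
def homothetySetoid (n : ℕ) : Setoid (ConvexBody (E n)) where
  r K L := ∃ c : ℝ, 0 < c ∧ ∃ t : E n, (L : Set (E n)) = (fun x => c • x + t) '' K
  iseqv :=
    { refl := fun K => ⟨1, one_pos, 0, by simp⟩
      symm := by
        rintro K L ⟨c, hc, t, h⟩
        refine ⟨c⁻¹, inv_pos.2 hc, -(c⁻¹ • t), ?_⟩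
        rw [h, Set.image_image]
        simp [smul_smul, inv_mul_cancel₀ hc.ne']
      trans := by
        rintro K L M ⟨c, hc, t, h⟩ ⟨d, hd, s, h'⟩
        refine ⟨d * c, mul_pos hd hc, d • t + s, ?_⟩
        rw [h', h, Set.image_image]
        simp [smul_smul, add_assoc] }

/-- The space of oriented shapes of all convex bodies of `ℝ^n`. -/
def OShape (n : ℕ) : Type := Quotient (homothetySetoid n)

/-- The oriented shape `[K]`. -/
def OShape.mk {n : ℕ} (K : ConvexBody (E n)) : OShape n := Quotient.mk (homothetySetoid n) K

/-- The map induced on oriented shapes by a linear isometric map. -/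
def OShape.map {m n : ℕ} (f : E m →ₗᵢ[ℝ] E n) : OShape m → OShape n :=
  Quotient.map (mapBody f) <| by
    rintro K L ⟨c, hc, t, h⟩
    refine ⟨c, hc, f t, ?_⟩
    change f '' (L : Set (E m)) = (fun x => c • x + f t) '' (f '' K)
    rw [h, Set.image_image, Set.image_image]
    simp

theorem OShape.map_map {l m n : ℕ} (g : E m →ₗᵢ[ℝ] E n) (f : E l →ₗᵢ[ℝ] E m)
    (x : OShape l) : OShape.map g (OShape.map f x) = OShape.map (g.comp f) x := by
  induction x using Quotient.inductionOn with
  | h K => exact congrArg OShape.mk (mapBody_comp g f K)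

theorem OShape.map_id {n : ℕ} (x : OShape n) : OShape.map LinearIsometry.id x = x := by
  induction x using Quotient.inductionOn with
  | h K => exact congrArg OShape.mk (ConvexBody.ext (Set.image_id _))

/-- The oriented shapes of the convex bodies of positive area. -/
def OShapeStar (n : ℕ) : Set (OShape n) := {x | ∃ K, 0 < area K ∧ OShape.mk K = x}

/-- The area metric: `d([K], [L])` is the value of `areaDist` on representatives. It does not
depend on the representatives, so that the infimum is over a one-element set for shapes of
positive area. -/
def OShape.dist {n : ℕ} (x y : OShape n) : ℝ :=
  sInf {r | ∃ K L, OShape.mk K = x ∧ OShape.mk L = y ∧ areaDist K L = r}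

/-! ### Shapes -/

/-- The orbit relation of `O(n)` on oriented shapes, where `Φ [K] = [Φ K]`. -/
def orthogonalSetoid (n : ℕ) : Setoid (OShape n) where
  r x y := ∃ Φ : E n ≃ₗᵢ[ℝ] E n, OShape.map Φ.toLinearIsometry x = y
  iseqv :=
    { refl := fun x => ⟨LinearIsometryEquiv.refl ℝ _, OShape.map_id x⟩
      symm := by
        rintro x y ⟨Φ, rfl⟩
        refine ⟨Φ.symm, ?_⟩
        rw [OShape.map_map]
        convert OShape.map_id x
        ext1 v
        simp
      trans := by
        rintro x y z ⟨Φ, rfl⟩ ⟨Ψ, rfl⟩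
        exact ⟨Φ.trans Ψ,
          (OShape.map_map Ψ.toLinearIsometry Φ.toLinearIsometry x).symm⟩ }

/-- The space of shapes of all convex bodies of `ℝ^n`. -/
def Shape (n : ℕ) : Type := Quotient (orthogonalSetoid n)

/-- The shape defined by an oriented shape. -/
def Shape.mk {n : ℕ} (x : OShape n) : Shape n := Quotient.mk (orthogonalSetoid n) x

/-- The map induced on shapes by the canonical embedding. -/
def Shape.incl {m n : ℕ} (h : m ≤ n) : Shape m → Shape n :=
  Quotient.map (OShape.map (Shapes.incl h)) <| by
    rintro x y ⟨Φ, rfl⟩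
    obtain ⟨Ψ, hΨ⟩ := exists_extension h Φ
    exact ⟨Ψ, by rw [OShape.map_map, OShape.map_map, hΨ]⟩

theorem Shape.incl_incl {l m n : ℕ} (h : l ≤ m) (h' : m ≤ n) (x : Shape l) :
    Shape.incl h' (Shape.incl h x) = Shape.incl (h.trans h') x := by
  induction x using Quotient.inductionOn with
  | h a =>
    refine congrArg Shape.mk ?_
    rw [OShape.map_map, incl_comp]

/-- The shapes of the convex bodies of positive area. -/
def ShapeStar (n : ℕ) : Set (Shape n) := {x | ∃ a ∈ OShapeStar n, Shape.mk a = x}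

/-- The quotient metric `inf_{Φ, Ψ ∈ O(n)} d(Φ [K], Ψ [L])`. -/
def Shape.dist {n : ℕ} (x y : Shape n) : ℝ :=
  sInf {r | ∃ a b, Shape.mk a = x ∧ Shape.mk b = y ∧ ∃ Φ Ψ : E n ≃ₗᵢ[ℝ] E n,
    OShape.dist (OShape.map Φ.toLinearIsometry a) (OShape.map Ψ.toLinearIsometry b) = r}

/-! ### The inductive limits -/

/-- Oriented shapes `x`, `y` in dimensions `i`, `j` are identified when they have the same image
in some dimension `p ≥ i, j`. -/
def oshapeInfSetoid : Setoid (Σ n : ℕ, OShapeStar n) where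
  r x y := ∃ (p : ℕ) (hi : x.1 ≤ p) (hj : y.1 ≤ p),
    OShape.map (incl hi) x.2.1 = OShape.map (incl hj) y.2.1
  iseqv :=
    { refl := fun x => ⟨x.1, le_rfl, le_rfl, rfl⟩
      symm := fun ⟨p, hi, hj, h⟩ => ⟨p, hj, hi, h.symm⟩
      trans := by
        rintro x y z ⟨p, hi, hj, h⟩ ⟨q, hj', hk, h'⟩
        refine ⟨max p q, hi.trans (le_max_left _ _), hk.trans (le_max_right _ _), ?_⟩
        have e := congrArg (OShape.map (incl (le_max_left p q))) h
        have e' := congrArg (OShape.map (incl (le_max_right p q))) h'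
        simp only [OShape.map_map, incl_comp] at e e'
        exact e.trans e' }

/-- The union over all dimensions of the spaces of oriented shapes of positive area. -/
def OShapeInf : Type := Quotient oshapeInfSetoid

/-- The class in `OShapeInf` of an oriented shape of positive area. -/
def OShapeInf.mk {n : ℕ} (x : OShapeStar n) : OShapeInf := Quotient.mk oshapeInfSetoid ⟨n, x⟩

/-- The distance on `OShapeInf`: that of two representatives in a common `ℝ^n` (on which it
does not depend), written as an infimum over all such representatives. -/
def OShapeInf.dist (x y : OShapeInf) : ℝ :=
  sInf {r | ∃ (n : ℕ) (a b : OShapeStar n), OShapeInf.mk a = x ∧ OShapeInf.mk b = y ∧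
    OShape.dist a.1 b.1 = r}

/-- Shapes `x`, `y` in dimensions `i`, `j` are identified when they have the same image
in some dimension `p ≥ i, j`. -/
def shapeInfSetoid : Setoid (Σ n : ℕ, ShapeStar n) where
  r x y := ∃ (p : ℕ) (hi : x.1 ≤ p) (hj : y.1 ≤ p),
    Shape.incl hi x.2.1 = Shape.incl hj y.2.1
  iseqv :=
    { refl := fun x => ⟨x.1, le_rfl, le_rfl, rfl⟩
      symm := fun ⟨p, hi, hj, h⟩ => ⟨p, hj, hi, h.symm⟩
      trans := by
        rintro x y z ⟨p, hi, hj, h⟩ ⟨q, hj', hk, h'⟩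
        refine ⟨max p q, hi.trans (le_max_left _ _), hk.trans (le_max_right _ _), ?_⟩
        have e := congrArg (Shape.incl (le_max_left p q)) h
        have e' := congrArg (Shape.incl (le_max_right p q)) h'
        simp only [Shape.incl_incl] at e e'
        exact e.trans e' }

/-- The union over all dimensions of the spaces of shapes of positive area. -/
def ShapeInf : Type := Quotient shapeInfSetoid

/-- The class in `ShapeInf` of a shape of positive area. -/
def ShapeInf.mk {n : ℕ} (x : ShapeStar n) : ShapeInf := Quotient.mk shapeInfSetoid ⟨n, x⟩

/-- The distance on `ShapeInf`: that of two representatives in a common `ℝ^n`, written as an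
infimum over all such representatives. -/
def ShapeInf.dist (x y : ShapeInf) : ℝ :=
  sInf {r | ∃ (n : ℕ) (a b : ShapeStar n), ShapeInf.mk a = x ∧ ShapeInf.mk b = y ∧
    Shape.dist a.1 b.1 = r}

/-- The oriented shape `[B^n]`, for `n ≥ 2`. -/
def oshapeBall (n : ℕ) (hn : 2 ≤ n) : OShapeStar n :=
  ⟨OShape.mk (unitBall n), unitBall n, area_unitBall_pos hn, rfl⟩

/-- The shape of `B^n`, for `n ≥ 2`. -/
def shapeBall (n : ℕ) (hn : 2 ≤ n) : ShapeStar n :=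
  ⟨Shape.mk (oshapeBall n hn).1, (oshapeBall n hn).1, (oshapeBall n hn).2, rfl⟩

/-- The sequence of the classes of `B^2, B^3, B^4, …` in `OShapeInf`. -/
def oshapeBallSeq (k : ℕ) : OShapeInf := OShapeInf.mk (oshapeBall (k + 2) (Nat.le_add_left 2 k))

/-- The sequence of the classes of `B^2, B^3, B^4, …` in `ShapeInf`. -/
def shapeBallSeq (k : ℕ) : ShapeInf := ShapeInf.mk (shapeBall (k + 2) (Nat.le_add_left 2 k))

/-! ### Completeness with respect to a distance -/

/-- `u` is a Cauchy sequence for the distance `d`. -/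
def IsCauchySeq {X : Type} (d : X → X → ℝ) (u : ℕ → X) : Prop :=
  ∀ ε : ℝ, 0 < ε → ∃ N, ∀ m n, N ≤ m → N ≤ n → d (u m) (u n) < ε

/-- `u` converges to `x` for the distance `d`. -/
def ConvergesTo {X : Type} (d : X → X → ℝ) (u : ℕ → X) (x : X) : Prop :=
  Tendsto (fun n => d (u n) x) atTop (𝓝 0)

/-- Every Cauchy sequence for the distance `d` converges. -/
def IsComplete {X : Type} (d : X → X → ℝ) : Prop :=
  ∀ u : ℕ → X, IsCauchySeq d u → ∃ x, ConvergesTo d u x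

end Shapes

end

noncomputable section

namespace Shapes

open ProbabilityTheory
open scoped RealInnerProductSpace

variable {n : ℕ}

/-! ### Metric projection onto a convex body -/

/-! The balls converge to a point that hyperbolic geometry provides but that no convex body
represents. Put `ρ(K) = V_1(K)² / (2 V_2(K))` (`isoRatio`). This number is unchanged by homotheties,
by `O(n)` and by the inclusions, so it descends to all the quotients. Writing `ρ(K) = cosh² a` and
`ρ(L) = cosh² b`, the key fact is that `cosh (a - b) ≤ V_2(K,L) / √(V_2(K) V_2(L)) ≤ cosh (a + b)`:
the distance behaves as if `a` and `b` were the distances to a common point `o`. Always `ρ > 1`, so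
`o` is not a shape, while `ρ(B^n) → 1`, so the balls tend to `o`. The upper bound gives the Cauchy
property; the lower bound keeps the balls away from every given shape.

The key fact says that the quadratic form `V_1² - 2 V_2` is positive semidefinite, followed by
Cauchy–Schwarz (`sq_sub_mixedArea_le`). With `G` standard Gaussian and `h` the support function,
`V_1 = √(2π) E h(G)` and `V_2 = π E (h(G)² - |∇h(G)|²)` (`intrinsicVolume_low`), so semidefiniteness
is the Gaussian Poincaré inequality for `s h_A + t h_B` (`gaussian_poincare`, `area_form_le`). These
formulas also show that `V_1` and `V_2` do not depend on the ambient dimension.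

The two formulas come from the Wills functional: integrating `exp (-dist(x, K)² / 2)` turns the
Steiner polynomial into `∑ V_i / √(2π)^i`. Applied to `μ K` it is a polynomial in `μ`, whose first
coefficients are found by expanding the integrand at `μ = 0`. The Steiner formula itself is obtained
by dilating the unit collar of `K` along normal rays, which has a Jacobian polynomial in the ratio.

Strictness `ρ > 1` (`two_mul_area_lt`) holds because equality would put `K` in the kernel of the
form; pairing with the ball would force `V_1(B^n) = V_1(B^(n-1))`, which the inequality `2 V_2 ≤
V_1²` for the ball of dimension `n + 2` excludes. -/

theorem exists_nearest (K : ConvexBody (E n)) (x : E n) :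
    ∃ v ∈ K, ∀ w ∈ K, ⟪x - v, w - v⟫ ≤ 0 := by
  obtain ⟨v, hv, h⟩ := exists_norm_eq_iInf_of_complete_convex K.nonempty
    K.isCompact.isComplete K.convex x
  exact ⟨v, hv, (norm_eq_iInf_iff_real_inner_le_zero K.convex hv).1 h⟩

/-- The point of `K` nearest to `x`. -/
def nearest (K : ConvexBody (E n)) (x : E n) : E n := (exists_nearest K x).choose

theorem nearest_mem (K : ConvexBody (E n)) (x : E n) : nearest K x ∈ K :=
  (exists_nearest K x).choose_spec.1

theorem inner_sub_nearest_le (K : ConvexBody (E n)) (x : E n) {w : E n} (hw : w ∈ K) :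
    ⟪x - nearest K x, w - nearest K x⟫ ≤ 0 :=
  (exists_nearest K x).choose_spec.2 w hw

/-- Sum of the two variational inequalities, each tested at the other projection. Beyond the
Lipschitz bound, it controls the derivative of the projection and hence the sign of a Jacobian. -/
theorem nearest_firmly_nonexpansive (K : ConvexBody (E n)) (x y : E n) :
    ‖nearest K x - nearest K y‖ ^ 2 ≤ ⟪x - y, nearest K x - nearest K y⟫ := by
  have h1 := inner_sub_nearest_le K x (nearest_mem K y)
  have h2 := inner_sub_nearest_le K y (nearest_mem K x)
  rw [← real_inner_self_eq_norm_sq]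
  simp only [inner_sub_left, inner_sub_right] at h1 h2 ⊢
  rw [real_inner_comm (nearest K x) (nearest K y)] at *
  linarith

theorem norm_nearest_sub_le (K : ConvexBody (E n)) (x y : E n) :
    ‖nearest K x - nearest K y‖ ≤ ‖x - y‖ := by
  have h1 := nearest_firmly_nonexpansive K x y
  have h2 := real_inner_le_norm (x - y) (nearest K x - nearest K y)
  by_contra! h
  nlinarith [norm_nonneg (x - y)]

theorem lipschitzWith_nearest (K : ConvexBody (E n)) : LipschitzWith 1 (nearest K) :=
  LipschitzWith.of_dist_le_mul fun x y => by
    simpa [dist_eq_norm] using norm_nearest_sub_le K x y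

theorem nearest_eq {K : ConvexBody (E n)} {x v : E n} (hv : v ∈ K)
    (h : ∀ w ∈ K, ⟪x - v, w - v⟫ ≤ 0) : nearest K x = v := by
  have h1 := inner_sub_nearest_le K x hv
  have h2 := h _ (nearest_mem K x)
  have h3 : ‖nearest K x - v‖ ^ 2 ≤ 0 := by
    rw [← real_inner_self_eq_norm_sq]
    simp only [inner_sub_left, inner_sub_right] at h1 h2 ⊢
    rw [real_inner_comm (nearest K x) v] at *
    linarith
  rw [← sub_eq_zero, ← norm_eq_zero]
  nlinarith [norm_nonneg (nearest K x - v)]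

theorem infDist_eq_norm_sub_nearest (K : ConvexBody (E n)) (x : E n) :
    Metric.infDist x (K : Set (E n)) = ‖x - nearest K x‖ := by
  refine le_antisymm ?_ ?_
  · rw [← dist_eq_norm]
    exact Metric.infDist_le_dist_of_mem (nearest_mem K x)
  · refine (Metric.le_infDist K.nonempty).2 fun {w} hw => ?_
    have h := inner_sub_nearest_le K x hw
    rw [dist_eq_norm]
    have h2 : ‖x - w‖ ^ 2 = ‖x - nearest K x‖ ^ 2 - 2 * ⟪x - nearest K x, w - nearest K x⟫ +
        ‖w - nearest K x‖ ^ 2 := by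
      rw [← norm_sub_sq_real]; congr 2; abel
    refine (sq_le_sq₀ (norm_nonneg _) (norm_nonneg _)).1 ?_
    nlinarith [sq_nonneg ‖w - nearest K x‖]

theorem infDist_le_iff_mem_add (K : ConvexBody (E n)) {r : ℝ} (hr : 0 ≤ r) (x : E n) :
    Metric.infDist x (K : Set (E n)) ≤ r ↔ x ∈ (K + r • unitBall n : ConvexBody (E n)) := by
  rw [← SetLike.mem_coe, ConvexBody.coe_add, ConvexBody.coe_smul]
  change _ ↔ x ∈ (K : Set (E n)) + r • Metric.closedBall (0 : E n) 1
  rw [smul_unitClosedBall, Real.norm_of_nonneg hr]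
  constructor
  · intro h
    rw [infDist_eq_norm_sub_nearest] at h
    exact ⟨nearest K x, nearest_mem K x, x - nearest K x, by simpa using h, by simp⟩
  · rintro ⟨k, hk, b, hb, rfl⟩
    refine (Metric.infDist_le_dist_of_mem hk).trans ?_
    simpa [dist_eq_norm] using hb

/-! ### Normal dilations and collars -/

/-- The dilation of ratio `s` along the normal rays of `K`. -/
def normalDilation (K : ConvexBody (E n)) (s : ℝ) (x : E n) : E n :=
  s • x + (1 - s) • nearest K x

theorem normalDilation_sub (K : ConvexBody (E n)) (s : ℝ) (x : E n) :
    normalDilation K s x - nearest K x = s • (x - nearest K x) := by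
  simp only [normalDilation]; module

/-- The dilation only rescales the normal vector `x - nearest K x`, which preserves the variational
inequality. Hence dilations compose multiplicatively and scale the distance to `K` by `s`. -/
theorem nearest_normalDilation (K : ConvexBody (E n)) {s : ℝ} (hs : 0 ≤ s) (x : E n) :
    nearest K (normalDilation K s x) = nearest K x := by
  refine nearest_eq (nearest_mem K x) fun w hw => ?_
  rw [normalDilation_sub, real_inner_smul_left]
  exact mul_nonpos_of_nonneg_of_nonpos hs (inner_sub_nearest_le K x hw)

theorem normalDilation_normalDilation (K : ConvexBody (E n)) {s : ℝ} (hs : 0 ≤ s) (t : ℝ)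
    (x : E n) : normalDilation K t (normalDilation K s x) = normalDilation K (t * s) x := by
  rw [normalDilation, nearest_normalDilation K hs]
  simp only [normalDilation]; module

theorem infDist_normalDilation (K : ConvexBody (E n)) {s : ℝ} (hs : 0 ≤ s) (x : E n) :
    Metric.infDist (normalDilation K s x) (K : Set (E n)) = s * Metric.infDist x K := by
  rw [infDist_eq_norm_sub_nearest, infDist_eq_norm_sub_nearest, nearest_normalDilation K hs,
    normalDilation_sub, norm_smul, Real.norm_of_nonneg hs]

theorem normalDilation_injective (K : ConvexBody (E n)) {s : ℝ} (hs : 0 < s) :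
    Function.Injective (normalDilation K s) := by
  refine Function.LeftInverse.injective (g := normalDilation K s⁻¹) fun x => ?_
  rw [normalDilation_normalDilation K hs.le, inv_mul_cancel₀ hs.ne']
  simp [normalDilation]

/-- The points outside `K` at distance at most `r`. -/
def collar (K : ConvexBody (E n)) (r : ℝ) : Set (E n) :=
  {x | Metric.infDist x (K : Set (E n)) ∈ Set.Ioc 0 r}

theorem measurableSet_collar (K : ConvexBody (E n)) (r : ℝ) : MeasurableSet (collar K r) :=
  (Metric.continuous_infDist_pt _).measurable measurableSet_Ioc

theorem normalDilation_image_collar (K : ConvexBody (E n)) {s : ℝ} (hs : 0 < s) :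
    normalDilation K s '' collar K 1 = collar K s := by
  ext y
  constructor
  · rintro ⟨x, ⟨h0, h1⟩, rfl⟩
    constructor
    · rw [infDist_normalDilation K hs.le]; positivity
    · rw [infDist_normalDilation K hs.le]; nlinarith
  · rintro ⟨h0, h1⟩
    refine ⟨normalDilation K s⁻¹ y, ⟨?_, ?_⟩, ?_⟩
    · rw [infDist_normalDilation K (by positivity)]; positivity
    · rw [infDist_normalDilation K (by positivity), inv_mul_le_iff₀ hs]; simpa using h1
    · rw [normalDilation_normalDilation K (by positivity), mul_inv_cancel₀ hs.ne']
      simp [normalDilation]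

theorem coe_add_smul_unitBall_eq (K : ConvexBody (E n)) {r : ℝ} (hr : 0 ≤ r) :
    ((K + r • unitBall n : ConvexBody (E n)) : Set (E n)) = (K : Set (E n)) ∪ collar K r := by
  ext x
  rw [SetLike.mem_coe, ← infDist_le_iff_mem_add K hr, Set.mem_union]
  have h0 : x ∈ (K : Set (E n)) ↔ Metric.infDist x (K : Set (E n)) = 0 :=
    K.isClosed.mem_iff_infDist_zero K.nonempty
  have h1 := Metric.infDist_nonneg (x := x) (s := (K : Set (E n)))
  rw [h0]
  change _ ↔ _ ∨ (_ < _ ∧ _ ≤ _)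
  constructor
  · intro h
    rcases h1.eq_or_lt with h2 | h2
    · exact Or.inl h2.symm
    · exact Or.inr ⟨h2, h⟩
  · rintro (h | h)
    · rw [h]; exact hr
    · exact h.2

theorem volume_real_add_smul_unitBall (K : ConvexBody (E n)) {r : ℝ} (hr : 0 ≤ r) :
    volume.real ((K + r • unitBall n : ConvexBody (E n)) : Set (E n)) =
      volume.real (K : Set (E n)) + volume.real (collar K r) := by
  have hb : ((K + r • unitBall n : ConvexBody (E n)) : Set (E n)) = _ :=
    coe_add_smul_unitBall_eq K hr
  have hfin : volume ((K + r • unitBall n : ConvexBody (E n)) : Set (E n)) ≠ ⊤ :=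
    (K + r • unitBall n).isCompact.measure_lt_top.ne
  rw [hb] at hfin ⊢
  refine measureReal_union ?_ (measurableSet_collar K r)
    (measure_ne_top_of_subset Set.subset_union_left hfin)
    (measure_ne_top_of_subset Set.subset_union_right hfin)
  refine Set.disjoint_left.2 fun x hx hx' => ?_
  have := (K.isClosed.mem_iff_infDist_zero K.nonempty).1 hx
  have h2 := hx'.1
  linarith

/-! ### The Steiner formula -/

/-- In matrix form the map is `s (1 - M) + M`, so its determinant is a polynomial in `s`. This is
the source of polynomiality in the Steiner formula. -/
theorem continuousLinearMap_det_eq_eval (A : E n →L[ℝ] E n) :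
    ∃ P : Polynomial ℝ, P.natDegree ≤ n ∧
      ∀ s : ℝ, (s • ContinuousLinearMap.id ℝ (E n) + (1 - s) • A).det = P.eval s := by
  let b := (EuclideanSpace.basisFun (Fin n) ℝ).toBasis
  let M := LinearMap.toMatrix b b A.toLinearMap
  refine ⟨(((Polynomial.X : Polynomial ℝ) • (1 - M).map Polynomial.C +
    M.map Polynomial.C : Matrix _ _ (Polynomial ℝ))).det, ?_, fun s => ?_⟩
  · simpa using Polynomial.natDegree_det_X_add_C_le (1 - M) M
  · rw [ContinuousLinearMap.det, ← LinearMap.det_toMatrix b, ← Polynomial.coe_evalRingHom,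
      RingHom.map_det]
    congr 1
    have h1 : ((s • ContinuousLinearMap.id ℝ (E n) + (1 - s) • A : E n →L[ℝ] E n) :
        E n →ₗ[ℝ] E n) = s • LinearMap.id + (1 - s) • A.toLinearMap := rfl
    rw [h1, map_add, map_smul, map_smul, LinearMap.toMatrix_id]
    ext i j
    by_cases hij : i = j <;> simp [M, hij] <;> ring

/-- A kernel vector `v` would give `s |v|² + (1 - s) ⟪v, A v⟫ = 0`, impossible since `0 ≤ ⟪v, A v⟫ ≤
|v|²`. The determinant thus has no zero on `s > 0`, and it equals `1` at `s = 1`. Positivity removes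
the absolute value from the change of variables, keeping the integrand polynomial in `s`. -/
theorem det_pos_of_firmly_nonexpansive {A : E n →L[ℝ] E n}
    (hA : ∀ v, ‖A v‖ ^ 2 ≤ ⟪v, A v⟫) {s : ℝ} (hs : 0 < s) :
    0 < (s • ContinuousLinearMap.id ℝ (E n) + (1 - s) • A).det := by
  obtain ⟨P, -, hP⟩ := continuousLinearMap_det_eq_eval A
  have hne : ∀ s : ℝ, 0 < s → P.eval s ≠ 0 := by
    intro s hs h
    rw [← hP] at h
    have hker := LinearMap.bot_lt_ker_of_det_eq_zero h
    obtain ⟨v, hv, hv0⟩ := Submodule.exists_mem_ne_zero_of_ne_bot hker.ne'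
    have hv1 : s • v + (1 - s) • A v = 0 := hv
    have h2 : s * ‖v‖ ^ 2 + (1 - s) * ⟪v, A v⟫ = 0 := by
      have := congrArg (fun w => ⟪v, w⟫) hv1
      simpa [inner_add_right, real_inner_smul_right] using this
    have h3 : 0 < ‖v‖ := norm_pos_iff.2 hv0
    have h4 := hA v
    have h5 : ⟪v, A v⟫ ≤ ‖v‖ * ‖A v‖ := real_inner_le_norm _ _
    have h6 : ‖A v‖ ≤ ‖v‖ := by
      by_contra! h
      nlinarith
    have h7 : ⟪v, A v⟫ ≤ ‖v‖ ^ 2 := by nlinarith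
    have h8 : 0 ≤ ⟪v, A v⟫ := (sq_nonneg _).trans h4
    have h9 : 0 < ‖v‖ ^ 2 := by positivity
    rcases le_total s 1 with h | h <;> nlinarith
  have h1 : 0 < P.eval 1 := by
    rw [← hP]; simp [ContinuousLinearMap.det]
  rw [hP]
  by_contra! hneg
  have hivt := isPreconnected_Ioi (a := (0 : ℝ)) |>.intermediate_value (f := fun x => P.eval x)
    (Set.mem_Ioi.2 hs) (Set.mem_Ioi.2 one_pos) P.continuous.continuousOn
  obtain ⟨t, ht, ht0⟩ := hivt ⟨hneg, h1.le⟩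
  exact hne t ht ht0

theorem fderiv_nearest_firmly_nonexpansive {K : ConvexBody (E n)} {x : E n}
    (hx : DifferentiableAt ℝ (nearest K) x) (v : E n) :
    ‖fderiv ℝ (nearest K) x v‖ ^ 2 ≤ ⟪v, fderiv ℝ (nearest K) x v⟫ := by
  have h := hx.hasFDerivAt.hasLineDerivAt v
  have h' := (hasLineDerivAt_iff_tendsto_slope_zero.1 h)
  refine le_of_tendsto_of_tendsto ((h'.norm).pow 2) (tendsto_const_nhds.inner h') ?_
  filter_upwards [self_mem_nhdsWithin] with t ht
  have ht' : t ≠ 0 := ht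
  have := nearest_firmly_nonexpansive K (x + t • v) x
  rw [norm_smul, mul_pow, real_inner_smul_right, Real.norm_eq_abs, sq_abs]
  rw [add_sub_cancel_left, real_inner_smul_left] at this
  calc _ ≤ (t⁻¹) ^ 2 * (t * ⟪v, nearest K (x + t • v) - nearest K x⟫) := by gcongr
    _ = _ := by field_simp

/-- Lipschitz maps control Hausdorff measure, which in dimension `n` is a multiple of Lebesgue
measure, both being translation invariant. -/
theorem volume_image_eq_zero_of_lipschitzWith {C : NNReal} {f : E n → E n}
    (hf : LipschitzWith C f) {s : Set (E n)} (hs : volume s = 0) : volume (f '' s) = 0 := by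
  have h1 : (volume : Measure (E n)) ≪ Measure.hausdorffMeasure n := by
    rw [Measure.isAddLeftInvariant_eq_smul (volume : Measure (E n)) (Measure.hausdorffMeasure n)]
    exact Measure.smul_absolutelyContinuous
  have h2 : (Measure.hausdorffMeasure n : Measure (E n)) ≪ volume := by
    rw [Measure.isAddLeftInvariant_eq_smul (Measure.hausdorffMeasure n) (volume : Measure (E n))]
    exact Measure.smul_absolutelyContinuous
  refine h1 (le_antisymm ((hf.hausdorffMeasure_image_le n.cast_nonneg s).trans ?_) zero_le)
  rw [h2 hs, mul_zero]

/-- Change of variables for the normal dilation from the unit collar. By Rademacher the projection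
is differentiable off a null set, and the Lipschitz dilation sends that set to a null set. -/
theorem volume_real_collar (K : ConvexBody (E n)) {s : ℝ} (hs : 0 < s) :
    IntegrableOn (fun x => (s • ContinuousLinearMap.id ℝ (E n) +
        (1 - s) • fderiv ℝ (nearest K) x).det) (collar K 1) ∧
    volume.real (collar K s) = ∫ x in collar K 1, (s • ContinuousLinearMap.id ℝ (E n) +
        (1 - s) • fderiv ℝ (nearest K) x).det := by
  have hfin : ∀ r, 0 ≤ r → volume (collar K r) ≠ ⊤ := fun r hr =>
    measure_ne_top_of_subset (Set.subset_union_right.trans (coe_add_smul_unitBall_eq K hr).superset)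
      (K + r • unitBall n).isCompact.measure_lt_top.ne
  set S := {x | DifferentiableAt ℝ (nearest K) x}
  have hSm : MeasurableSet S := measurableSet_of_differentiableAt ℝ _
  have hS : ∀ᵐ x, x ∈ S := (lipschitzWith_nearest K).ae_differentiableAt
  have hae : (collar K 1 ∩ S : Set (E n)) =ᵐ[volume] collar K 1 := by
    filter_upwards [hS] with x hx
    exact propext ⟨fun h => h.1, fun h => ⟨h, hx⟩⟩
  have hd : ∀ x ∈ collar K 1 ∩ S, HasFDerivWithinAt (normalDilation K s)
      (s • ContinuousLinearMap.id ℝ (E n) + (1 - s) • fderiv ℝ (nearest K) x)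
      (collar K 1 ∩ S) x := fun x hx =>
    (((hasFDerivAt_id x).const_smul s).add
      ((show DifferentiableAt ℝ (nearest K) x from hx.2).hasFDerivAt.const_smul
        (1 - s))).hasFDerivWithinAt
  have hm := (measurableSet_collar K 1).inter hSm
  have hinj : Set.InjOn (normalDilation K s) (collar K 1 ∩ S) :=
    (normalDilation_injective K hs).injOn
  have hlip : LipschitzWith (‖s‖₊ * 1 + ‖1 - s‖₊ * 1) (normalDilation K s) :=
    ((lipschitzWith_smul s).comp LipschitzWith.id).add
      ((lipschitzWith_smul (1 - s)).comp (lipschitzWith_nearest K))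
  have himg : (normalDilation K s '' (collar K 1 ∩ S) : Set (E n)) =ᵐ[volume] collar K s := by
    rw [← normalDilation_image_collar K hs]
    refine (Set.image_mono Set.inter_subset_left).eventuallyLE.antisymm ?_
    have hnull : volume (normalDilation K s '' (collar K 1 \ S)) = 0 := by
      have h1 : volume (collar K 1 \ S) = 0 := by
        refine measure_mono_null (fun x hx => hx.2) (ae_iff.1 hS)
      exact volume_image_eq_zero_of_lipschitzWith hlip h1
    refine ae_le_set.2 (measure_mono_null ?_ hnull)
    rintro _ ⟨⟨x, hx, rfl⟩, h⟩
    exact ⟨x, ⟨hx, fun hxS => h ⟨x, ⟨hx, hxS⟩, rfl⟩⟩, rfl⟩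
  have habs : ∀ x ∈ collar K 1 ∩ S, |(s • ContinuousLinearMap.id ℝ (E n) +
      (1 - s) • fderiv ℝ (nearest K) x).det| • (1 : ℝ) = (s • ContinuousLinearMap.id ℝ (E n) +
      (1 - s) • fderiv ℝ (nearest K) x).det := fun x hx => by
    rw [smul_eq_mul, mul_one, abs_of_pos]
    exact det_pos_of_firmly_nonexpansive (fderiv_nearest_firmly_nonexpansive hx.2) hs
  constructor
  · rw [← integrableOn_congr_set_ae hae]
    refine (integrableOn_congr_fun habs hm).1 ?_
    refine (integrableOn_image_iff_integrableOn_abs_det_fderiv_smul volume hm hd hinj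
      (fun _ => (1 : ℝ))).1 ?_
    rw [integrableOn_congr_set_ae himg]
    exact integrableOn_const (hfin s hs.le)
  · rw [← setIntegral_congr_set hae, ← setIntegral_congr_fun hm habs,
      ← integral_image_eq_integral_abs_det_fderiv_smul volume hm hd hinj (fun _ => (1 : ℝ)),
      setIntegral_congr_set himg]
    simp [Measure.real]

/-- The integrand is, for each point, a polynomial in `s` of degree at most `n`. Lagrange
interpolation at `n + 1` fixed nodes expresses it through its values there, so integrability of
individual coefficients is never needed. -/
theorem exists_polynomial_volume_collar (K : ConvexBody (E n)) :
    ∃ P : Polynomial ℝ, P.natDegree ≤ n ∧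
      ∀ s : ℝ, 0 < s → volume.real (collar K s) = P.eval s := by
  let t := Finset.range (n + 1)
  -- The shift by one keeps every node positive, as the Jacobian formula requires `s > 0`.
  let v : ℕ → ℝ := fun i => i + 1
  have hv : Set.InjOn v t := fun i _ j _ h => by simpa [v] using h
  have hv0 : ∀ i, 0 < v i := fun i => by positivity
  refine ⟨∑ i ∈ t, Polynomial.C (volume.real (collar K (v i))) * Lagrange.basis t v i, ?_, ?_⟩
  · refine Polynomial.natDegree_sum_le_of_forall_le _ _ fun i hi => ?_
    refine (Polynomial.natDegree_C_mul_le _ _).trans ?_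
    rw [Lagrange.natDegree_basis hv hi]
    simp [t]
  · intro s hs
    rw [Polynomial.eval_finsetSum, (volume_real_collar K hs).2]
    have h1 : ∀ x, (s • ContinuousLinearMap.id ℝ (E n) + (1 - s) • fderiv ℝ (nearest K) x).det =
        ∑ i ∈ t, (v i • ContinuousLinearMap.id ℝ (E n) +
          (1 - v i) • fderiv ℝ (nearest K) x).det * (Lagrange.basis t v i).eval s := by
      intro x
      obtain ⟨P, hP, h⟩ := continuousLinearMap_det_eq_eval (fderiv ℝ (nearest K) x)
      simp only [h]
      have hdeg : P.degree < t.card := by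
        refine Polynomial.degree_le_natDegree.trans_lt ?_
        simp only [t, Finset.card_range]
        exact_mod_cast Nat.lt_succ_of_le hP
      conv_lhs => rw [Lagrange.eq_interpolate hv hdeg]
      simp [Lagrange.interpolate_apply, Polynomial.eval_finsetSum]
    simp_rw [h1]
    rw [integral_finsetSum]
    · refine Finset.sum_congr rfl fun i _ => ?_
      rw [integral_mul_const, ← (volume_real_collar K (hv0 i)).2]
      simp
    · intro i _
      exact (volume_real_collar K (hv0 i)).1.mul_const _

/-- Rules out the default value `0` of `intrinsicVolume`: the Steiner expansion exists for every
body. The coefficient of `ε^(n-i)` carries `V_i`. -/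
theorem exists_isSteinerCoeff (K : ConvexBody (E n)) : ∃ V, IsSteinerCoeff K V := by
  obtain ⟨P, hP, h⟩ := exists_polynomial_volume_collar K
  let Q := P + Polynomial.C (volume.real (K : Set (E n)))
  have hQ : Q.natDegree ≤ n := by simpa [Q] using hP
  refine ⟨fun i => if i ≤ n then Q.coeff (n - i) / kappa (n - i) else 0,
    fun i hi => if_neg (by omega), fun ε hε => ?_⟩
  rw [volume_real_add_smul_unitBall K hε.le, h ε hε]
  have : volume.real (K : Set (E n)) + P.eval ε = Q.eval ε := by simp [Q, add_comm]
  rw [this, Polynomial.eval_eq_sum_range' (Nat.lt_succ_of_le hQ), ← Finset.sum_range_reflect]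
  refine Finset.sum_congr rfl fun i hi => ?_
  have hi' := Finset.mem_range.1 hi
  have := (kappa_pos (n - i)).ne'
  have e : n + 1 - 1 - i = n - i := by omega
  have hi2 : i ≤ n := by omega
  simp only [Nat.succ_eq_add_one, e, if_pos hi2]
  field_simp

theorem isSteinerCoeff_intrinsicVolume (K : ConvexBody (E n)) :
    IsSteinerCoeff K (fun i => intrinsicVolume i K) := by
  obtain ⟨V, hV⟩ := exists_isSteinerCoeff K
  convert hV using 1
  funext i
  exact hV.intrinsicVolume_eq i

/-! ### The standard Gaussian measure -/

/-- The standard Gaussian measure of `ℝ^n`. -/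
abbrev gauss (n : ℕ) : Measure (E n) := stdGaussian (E n)

theorem integral_exp_neg_norm_sq (n : ℕ) :
    ∫ x : E n, Real.exp (-‖x‖ ^ 2 / 2) = √(2 * Real.pi) ^ n := by
  have h := GaussianFourier.integral_rexp_neg_mul_sq_norm (V := E n) (b := 1 / 2) (by norm_num)
  have e : ∀ x : E n, Real.exp (-‖x‖ ^ 2 / 2) = Real.exp (-(1 / 2) * ‖x‖ ^ 2) := fun x => by
    congr 1; ring
  simp_rw [e]
  rw [h, finrank_euclideanSpace_fin, Real.sqrt_eq_rpow, ← Real.rpow_natCast, ← Real.rpow_mul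
    (by positivity)]
  congr 1
  · ring
  · ring

theorem integrable_exp_neg_norm_sq (n : ℕ) :
    Integrable fun x : E n => Real.exp (-‖x‖ ^ 2 / 2) := by
  refine Integrable.of_integral_ne_zero ?_
  rw [integral_exp_neg_norm_sq]
  positivity

/-- The density of the standard Gaussian measure. -/
def gaussDensity (n : ℕ) (x : E n) : ℝ := (√(2 * Real.pi) ^ n)⁻¹ * Real.exp (-‖x‖ ^ 2 / 2)

theorem gaussDensity_pos (x : E n) : 0 < gaussDensity n x := by
  unfold gaussDensity; positivity

theorem measurable_gaussDensity : Measurable (gaussDensity n) := by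
  unfold gaussDensity; fun_prop

/-- The two finite measures have the same characteristic function, by the Gaussian Fourier integral.
-/
theorem gauss_eq_withDensity (n : ℕ) :
    gauss n = volume.withDensity fun x => ENNReal.ofReal (gaussDensity n x) := by
  have hint : Integrable (gaussDensity n) := (integrable_exp_neg_norm_sq n).const_mul _
  have : IsFiniteMeasure (volume.withDensity fun x => ENNReal.ofReal (gaussDensity n x)) :=
    isFiniteMeasure_withDensity_ofReal hint.2
  refine Measure.ext_of_charFun ?_
  ext t
  rw [charFun_stdGaussian, charFun_apply, integral_withDensity_eq_integral_toReal_smul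
    (measurable_gaussDensity.ennreal_ofReal) (by simp)]
  have h := GaussianFourier.integral_cexp_neg_mul_sq_norm_add (V := E n) (b := 1 / 2)
    (by norm_num) Complex.I t
  have e : ∀ x : E n, (ENNReal.ofReal (gaussDensity n x)).toReal •
      Complex.exp (⟪x, t⟫ * Complex.I) = ((√(2 * Real.pi) ^ n)⁻¹ : ℝ) *
        Complex.exp (-(1 / 2) * ‖x‖ ^ 2 + Complex.I * ⟪t, x⟫) := by
    intro x
    rw [ENNReal.toReal_ofReal (gaussDensity_pos x).le, gaussDensity, Complex.real_smul,
      Complex.exp_add, real_inner_comm]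
    push_cast
    rw [mul_assoc]
    congr 2
    · congr 1; ring
    · congr 1; ring
  simp_rw [e]
  rw [integral_const_mul, h, ← mul_assoc]
  have e2 : (((√(2 * Real.pi) ^ n)⁻¹ : ℝ) : ℂ) *
      ((Real.pi : ℂ) / (1 / 2)) ^ ((Module.finrank ℝ (E n) : ℂ) / 2) = 1 := by
    have h3 : ((Real.pi : ℂ) / (1 / 2)) ^ ((Module.finrank ℝ (E n) : ℂ) / 2) =
        ((√(2 * Real.pi) ^ n : ℝ) : ℂ) := by
      rw [finrank_euclideanSpace_fin, Real.sqrt_eq_rpow, ← Real.rpow_natCast, ← Real.rpow_mul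
        (by positivity), Complex.ofReal_cpow (by positivity)]
      push_cast
      congr 1
      · ring
      · ring
    rw [h3, ← Complex.ofReal_mul, inv_mul_cancel₀ (by positivity), Complex.ofReal_one]
  rw [e2, one_mul, Complex.I_sq]
  congr 1
  ring

theorem integral_gauss (f : E n → ℝ) :
    ∫ x, f x ∂gauss n = ∫ x, gaussDensity n x * f x := by
  rw [gauss_eq_withDensity, integral_withDensity_eq_integral_toReal_smul
    (measurable_gaussDensity.ennreal_ofReal) (by simp)]
  simp_rw [ENNReal.toReal_ofReal (gaussDensity_pos _).le, smul_eq_mul]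

theorem gauss_absolutelyContinuous : gauss n ≪ volume := by
  rw [gauss_eq_withDensity]; exact withDensity_absolutelyContinuous _ _

/-- A linear isometric map pulls the standard Gaussian measure back to the standard Gaussian
measure through its adjoint. -/
theorem gauss_map_adjoint {m n : ℕ} (f : E m →ₗᵢ[ℝ] E n) :
    (gauss n).map (f.toContinuousLinearMap.adjoint) = gauss m := by
  refine Measure.ext_of_charFun ?_
  ext t
  rw [charFun_apply, integral_map (by fun_prop) (by fun_prop)]
  have : ∀ x : E n, ⟪f.toContinuousLinearMap.adjoint x, t⟫ = ⟪x, f t⟫ := fun x =>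
    ContinuousLinearMap.adjoint_inner_left _ _ _
  simp_rw [this]
  rw [← charFun_apply, charFun_stdGaussian, charFun_stdGaussian, f.norm_map]

/-! ### The Wills functional -/

theorem lintegral_Ioi_mul_exp_neg_sq {d : ℝ} (hd : 0 ≤ d) :
    ∫⁻ r in Set.Ioi d, ENNReal.ofReal (r * Real.exp (-r ^ 2 / 2)) =
      ENNReal.ofReal (Real.exp (-d ^ 2 / 2)) := by
  have hder : ∀ x : ℝ, HasDerivAt (fun r : ℝ => -Real.exp (-r ^ 2 / 2))
      (x * Real.exp (-x ^ 2 / 2)) x := fun x => by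
    refine (((hasDerivAt_pow 2 x).fun_neg.div_const 2).exp).fun_neg.congr_deriv ?_
    push_cast
    ring
  have hlim : Tendsto (fun r : ℝ => -Real.exp (-r ^ 2 / 2)) atTop (𝓝 0) := by
    rw [← neg_zero]
    refine (Real.tendsto_exp_atBot.comp ?_).neg
    have : Tendsto (fun r : ℝ => r ^ 2 / 2) atTop atTop :=
      (tendsto_pow_atTop two_ne_zero).atTop_div_const two_pos
    exact (tendsto_neg_atTop_atBot.comp this).congr fun x => (neg_div 2 (x ^ 2)).symm
  have hnn : ∀ x ∈ Set.Ioi d, 0 ≤ x * Real.exp (-x ^ 2 / 2) := fun x hx =>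
    mul_nonneg (hd.trans (le_of_lt hx)) (Real.exp_pos _).le
  have hcont : ContinuousWithinAt (fun r : ℝ => -Real.exp (-r ^ 2 / 2)) (Set.Ici d) d :=
    (hder d).continuousAt.continuousWithinAt
  rw [← ofReal_integral_eq_lintegral_ofReal
    (integrableOn_Ioi_deriv_of_nonneg hcont (fun x _ => hder x) hnn hlim)
    ((ae_restrict_iff' measurableSet_Ioi).2 (ae_of_all _ hnn)),
    integral_Ioi_of_hasDerivAt_of_nonneg hcont (fun x _ => hder x) hnn hlim]
  simp

/-- Layer cake: `exp (-d²/2)` is the integral of `r exp (-r²/2)` over `r > d`, and after Tonelli the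
set of points with `d ≤ r` is the parallel body `K + r B`. -/
theorem lintegral_exp_neg_infDist_sq (K : ConvexBody (E n)) :
    ∫⁻ x : E n, ENNReal.ofReal (Real.exp (-Metric.infDist x (K : Set (E n)) ^ 2 / 2)) =
      ∫⁻ r in Set.Ioi (0 : ℝ), ENNReal.ofReal (r * Real.exp (-r ^ 2 / 2)) *
        volume ((K + r • unitBall n : ConvexBody (E n)) : Set (E n)) := by
  let F : E n → ℝ → ENNReal := fun x r =>
    (Set.Ici (Metric.infDist x (K : Set (E n)))).indicator
      (fun r => ENNReal.ofReal (r * Real.exp (-r ^ 2 / 2))) r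
  have hF : Measurable (Function.uncurry F) := by
    have h1 : MeasurableSet {p : E n × ℝ | Metric.infDist p.1 (K : Set (E n)) ≤ p.2} :=
      measurableSet_le ((Metric.continuous_infDist_pt _).measurable.comp measurable_fst)
        measurable_snd
    have h2 : Measurable fun p : E n × ℝ => ENNReal.ofReal (p.2 * Real.exp (-p.2 ^ 2 / 2)) := by
      fun_prop
    exact h2.indicator h1
  calc _ = ∫⁻ x : E n, ∫⁻ r in Set.Ioi (0 : ℝ), F x r := by
        refine lintegral_congr fun x => ?_
        have hd := Metric.infDist_nonneg (x := x) (s := (K : Set (E n)))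
        rw [← lintegral_Ioi_mul_exp_neg_sq hd, lintegral_indicator measurableSet_Ici,
          Measure.restrict_restrict measurableSet_Ici]
        refine setLIntegral_congr ?_
        -- The closed half-line from the distance gives the closed parallel body; it differs from
        -- the open half-line by one point, a null set.
        filter_upwards [Measure.ae_ne volume (Metric.infDist x (K : Set (E n)))] with r hr
        refine propext ⟨fun h => ⟨le_of_lt h, hd.trans_lt h⟩, fun h => ?_⟩
        exact lt_of_le_of_ne h.1 hr.symm
    _ = ∫⁻ r in Set.Ioi (0 : ℝ), ∫⁻ x : E n, F x r :=
        lintegral_lintegral_swap hF.aemeasurable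
    _ = _ := by
        refine setLIntegral_congr_fun measurableSet_Ioi fun r hr => ?_
        have hset : ((K + r • unitBall n : ConvexBody (E n)) : Set (E n)) =
            {x | Metric.infDist x (K : Set (E n)) ≤ r} := by
          ext x
          exact (infDist_le_iff_mem_add K (le_of_lt hr) x).symm
        have hF2 : ∀ x, F x r = {x | Metric.infDist x (K : Set (E n)) ≤ r}.indicator
            (fun _ => ENNReal.ofReal (r * Real.exp (-r ^ 2 / 2))) x := fun x => rfl
        simp_rw [hF2, hset]
        rw [lintegral_indicator_const]
        exact measurableSet_le (Metric.continuous_infDist_pt _).measurable measurable_const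

theorem integrableOn_pow_mul_exp_neg_sq (m : ℕ) :
    IntegrableOn (fun r : ℝ => r ^ m * Real.exp (-r ^ 2 / 2)) (Set.Ioi 0) := by
  have h := integrableOn_rpow_mul_exp_neg_mul_sq (b := 1 / 2) (by norm_num) (s := m)
    (by have : (0 : ℝ) ≤ m := m.cast_nonneg
        linarith)
  refine h.congr_fun (fun r _ => ?_) measurableSet_Ioi
  simp only [Real.rpow_natCast]
  congr 2; ring

theorem integral_exp_neg_infDist_sq_eq_sum (K : ConvexBody (E n)) {V : ℕ → ℝ}
    (hV : IsSteinerCoeff K V) :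
    ∫ x : E n, Real.exp (-Metric.infDist x (K : Set (E n)) ^ 2 / 2) =
      ∑ i ∈ Finset.range (n + 1), (kappa (n - i) *
        ∫ r in Set.Ioi (0 : ℝ), r ^ (n - i + 1) * Real.exp (-r ^ 2 / 2)) * V i := by
  have hvol : ∀ r ∈ Set.Ioi (0 : ℝ), ENNReal.ofReal (r * Real.exp (-r ^ 2 / 2)) *
      volume ((K + r • unitBall n : ConvexBody (E n)) : Set (E n)) =
      ENNReal.ofReal (∑ i ∈ Finset.range (n + 1), (kappa (n - i) * V i) *
        (r ^ (n - i + 1) * Real.exp (-r ^ 2 / 2))) := by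
    intro r hr
    have hr' : 0 < r := hr
    rw [← ENNReal.ofReal_toReal (K + r • unitBall n).isCompact.measure_lt_top.ne,
      ← ENNReal.ofReal_mul (by positivity)]
    congr 1
    change _ * volume.real _ = _
    rw [hV.2 r hr, Finset.mul_sum]
    refine Finset.sum_congr rfl fun i _ => ?_
    ring
  have hint : Integrable (fun r => ∑ i ∈ Finset.range (n + 1), (kappa (n - i) * V i) *
        (r ^ (n - i + 1) * Real.exp (-r ^ 2 / 2))) (volume.restrict (Set.Ioi (0 : ℝ))) :=
    integrable_finsetSum _ fun i _ => (integrableOn_pow_mul_exp_neg_sq _).const_mul _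
  have hnn : ∀ r ∈ Set.Ioi (0 : ℝ), 0 ≤ ∑ i ∈ Finset.range (n + 1), (kappa (n - i) * V i) *
        (r ^ (n - i + 1) * Real.exp (-r ^ 2 / 2)) := by
    intro r hr
    have hr' : 0 < r := hr
    have : ∑ i ∈ Finset.range (n + 1), (kappa (n - i) * V i) *
        (r ^ (n - i + 1) * Real.exp (-r ^ 2 / 2)) = r * Real.exp (-r ^ 2 / 2) *
        volume.real ((K + r • unitBall n : ConvexBody (E n)) : Set (E n)) := by
      rw [hV.2 r hr, Finset.mul_sum]
      exact Finset.sum_congr rfl fun i _ => by ring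
    rw [this]
    positivity
  have hcont : Continuous fun x : E n =>
      Real.exp (-Metric.infDist x (K : Set (E n)) ^ 2 / 2) := by
    have := Metric.continuous_infDist_pt (K : Set (E n))
    fun_prop
  rw [integral_eq_lintegral_of_nonneg_ae (ae_of_all _ fun x => (Real.exp_pos _).le)
    hcont.aestronglyMeasurable, lintegral_exp_neg_infDist_sq,
    setLIntegral_congr_fun measurableSet_Ioi hvol,
    ← ofReal_integral_eq_lintegral_ofReal hint
      ((ae_restrict_iff' measurableSet_Ioi).2 (ae_of_all _ hnn)), ENNReal.toReal_ofReal
      (setIntegral_nonneg measurableSet_Ioi hnn), integral_finsetSum]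
  · refine Finset.sum_congr rfl fun i _ => ?_
    rw [integral_const_mul]
    ring
  · exact fun i _ => (integrableOn_pow_mul_exp_neg_sq _).const_mul _

/-- The Steiner formula of a point. -/
theorem isSteinerCoeff_zero (n : ℕ) :
    IsSteinerCoeff (0 : ConvexBody (E n)) (fun i => if i = 0 then 1 else 0) := by
  refine ⟨fun i hi => if_neg (by omega), fun ε hε => ?_⟩
  rw [zero_add, ConvexBody.coe_smul, Measure.real, Measure.addHaar_smul_of_nonneg volume hε.le,
    ENNReal.toReal_mul, ENNReal.toReal_ofReal (by positivity), finrank_euclideanSpace_fin,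
    Finset.sum_eq_single 0]
  · simp [kappa, Measure.real]
  · intro i _ hi
    simp [hi]
  · simp

/-- The preceding identity for a single point, where the left side is the total Gaussian integral.
This evaluates the radial constants without polar coordinates. -/
theorem kappa_mul_integral (m : ℕ) :
    kappa m * ∫ r in Set.Ioi (0 : ℝ), r ^ (m + 1) * Real.exp (-r ^ 2 / 2) =
      √(2 * Real.pi) ^ m := by
  have h := integral_exp_neg_infDist_sq_eq_sum _ (isSteinerCoeff_zero m)
  rw [Finset.sum_eq_single 0 (by intro i _ hi; simp [hi]) (by simp)] at h
  rw [← integral_exp_neg_norm_sq]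
  simpa [← Set.singleton_zero] using h.symm

/-- **Wills functional**: the Gaussian generating function of the intrinsic volumes. -/
theorem integral_gauss_exp_infDist (K : ConvexBody (E n)) :
    ∫ x, Real.exp ((‖x‖ ^ 2 - Metric.infDist x (K : Set (E n)) ^ 2) / 2) ∂gauss n =
      ∑ i ∈ Finset.range (n + 1), intrinsicVolume i K / √(2 * Real.pi) ^ i := by
  rw [integral_gauss]
  have e : ∀ x : E n, gaussDensity n x *
      Real.exp ((‖x‖ ^ 2 - Metric.infDist x (K : Set (E n)) ^ 2) / 2) =
      (√(2 * Real.pi) ^ n)⁻¹ * Real.exp (-Metric.infDist x (K : Set (E n)) ^ 2 / 2) := by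
    intro x
    rw [gaussDensity, mul_assoc, ← Real.exp_add]
    congr 2; ring
  simp_rw [e]
  rw [integral_const_mul, integral_exp_neg_infDist_sq_eq_sum K
    (isSteinerCoeff_intrinsicVolume K), Finset.mul_sum]
  refine Finset.sum_congr rfl fun i hi => ?_
  have hi' : i ≤ n := by have := Finset.mem_range.1 hi; omega
  rw [kappa_mul_integral]
  have h2 : √(2 * Real.pi) ^ n = √(2 * Real.pi) ^ (n - i) * √(2 * Real.pi) ^ i := by
    rw [← pow_add]; congr 1; omega
  have h3 : √(2 * Real.pi) ≠ 0 := by positivity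
  rw [h2]
  field_simp

theorem isSteinerCoeff_smul {K : ConvexBody (E n)} {V : ℕ → ℝ} (hV : IsSteinerCoeff K V)
    {c : ℝ} (hc : 0 < c) : IsSteinerCoeff (c • K) (fun i => c ^ i * V i) := by
  refine ⟨fun i hi => by simp [hV.1 i hi], fun ε hε => ?_⟩
  have h1 : (c • K + ε • unitBall n : ConvexBody (E n)) = c • (K + (ε / c) • unitBall n) := by
    rw [smul_add, smul_smul, mul_div_cancel₀ _ hc.ne']
  rw [h1, ConvexBody.coe_smul, Measure.real, Measure.addHaar_smul_of_nonneg volume hc.le,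
    ENNReal.toReal_mul, ENNReal.toReal_ofReal (by positivity), finrank_euclideanSpace_fin]
  change _ * volume.real _ = _
  rw [hV.2 _ (by positivity), Finset.mul_sum]
  refine Finset.sum_congr rfl fun i hi => ?_
  have hi' : i ≤ n := by have := Finset.mem_range.1 hi; omega
  have h2 : c ^ n = c ^ (n - i) * c ^ i := by
    rw [← pow_add]; congr 1; omega
  rw [h2, div_pow]
  field_simp

theorem intrinsicVolume_smul (K : ConvexBody (E n)) {c : ℝ} (hc : 0 < c) (i : ℕ) :
    intrinsicVolume i (c • K) = c ^ i * intrinsicVolume i K :=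
  (isSteinerCoeff_smul (isSteinerCoeff_intrinsicVolume K) hc).intrinsicVolume_eq i

/-! ### Support functions -/

/-- The support function of a convex body. -/
def supportFun (K : ConvexBody (E n)) (x : E n) : ℝ := sSup ((fun k => ⟪x, k⟫) '' (K : Set (E n)))

theorem isCompact_inner_image (K : ConvexBody (E n)) (x : E n) :
    IsCompact ((fun k => ⟪x, k⟫) '' (K : Set (E n))) :=
  K.isCompact.image (by fun_prop)

theorem le_supportFun {K : ConvexBody (E n)} {k : E n} (hk : k ∈ K) (x : E n) :
    ⟪x, k⟫ ≤ supportFun K x :=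
  le_csSup (isCompact_inner_image K x).bddAbove ⟨k, hk, rfl⟩

theorem exists_inner_eq_supportFun (K : ConvexBody (E n)) (x : E n) :
    ∃ k ∈ K, ⟪x, k⟫ = supportFun K x := by
  obtain ⟨k, hk, h⟩ := (isCompact_inner_image K x).sSup_mem (K.nonempty.image _)
  exact ⟨k, hk, h⟩

theorem exists_norm_le (K : ConvexBody (E n)) : ∃ R, 0 ≤ R ∧ ∀ k ∈ K, ‖k‖ ≤ R := by
  obtain ⟨R, hR⟩ := K.isBounded.exists_norm_le
  obtain ⟨k, hk⟩ := K.nonempty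
  exact ⟨R, (norm_nonneg k).trans (hR k hk), hR⟩

theorem supportFun_add (K L : ConvexBody (E n)) (x : E n) :
    supportFun (K + L) x = supportFun K x + supportFun L x := by
  apply le_antisymm
  · obtain ⟨m, hm, h⟩ := exists_inner_eq_supportFun (K + L) x
    rw [← SetLike.mem_coe, ConvexBody.coe_add] at hm
    obtain ⟨k, hk, l, hl, rfl⟩ := hm
    rw [← h, inner_add_right]
    exact add_le_add (le_supportFun hk x) (le_supportFun hl x)
  · obtain ⟨k, hk, h⟩ := exists_inner_eq_supportFun K x
    obtain ⟨l, hl, h'⟩ := exists_inner_eq_supportFun L x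
    rw [← h, ← h', ← inner_add_right]
    refine le_supportFun ?_ x
    rw [← SetLike.mem_coe, ConvexBody.coe_add]
    exact Set.add_mem_add hk hl

theorem supportFun_sub_le {K : ConvexBody (E n)} {R : ℝ} (hR : ∀ k ∈ K, ‖k‖ ≤ R) (x y : E n) :
    supportFun K x - supportFun K y ≤ R * ‖x - y‖ := by
  obtain ⟨k, hk, h⟩ := exists_inner_eq_supportFun K x
  have h1 := le_supportFun hk y
  have h2 : ⟪x - y, k⟫ ≤ ‖x - y‖ * ‖k‖ := real_inner_le_norm _ _
  rw [inner_sub_left] at h2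
  nlinarith [hR k hk, norm_nonneg (x - y)]

theorem lipschitzWith_supportFun {K : ConvexBody (E n)} {R : NNReal}
    (hR : ∀ k ∈ K, ‖k‖ ≤ R) : LipschitzWith R (supportFun K) :=
  LipschitzWith.of_le_add_mul R fun x y => by
    rw [dist_eq_norm]
    linarith [supportFun_sub_le hR x y]

theorem exists_lipschitzWith_supportFun (K : ConvexBody (E n)) :
    ∃ C, LipschitzWith C (supportFun K) := by
  obtain ⟨R, hR0, hR⟩ := exists_norm_le K
  exact ⟨⟨R, hR0⟩, lipschitzWith_supportFun hR⟩

theorem abs_supportFun_le {K : ConvexBody (E n)} {R : ℝ} (hR : ∀ k ∈ K, ‖k‖ ≤ R) (x : E n) :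
    |supportFun K x| ≤ R * ‖x‖ := by
  obtain ⟨k, hk, h⟩ := exists_inner_eq_supportFun K x
  rw [← h]
  have := abs_real_inner_le_norm x k
  nlinarith [hR k hk, norm_nonneg x]

/-- The function `h_K - ⟪·, k⟫` is nonnegative and vanishes at `x`, so its gradient there is zero.
-/
theorem gradient_supportFun {K : ConvexBody (E n)} {x k : E n}
    (hx : DifferentiableAt ℝ (supportFun K) x) (hk : k ∈ K) (h : ⟪x, k⟫ = supportFun K x) :
    gradient (supportFun K) x = k := by
  have hmin : IsLocalMin (fun y => supportFun K y - ⟪y, k⟫) x :=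
    Filter.Eventually.of_forall fun y => by
      have := le_supportFun hk y
      simp only
      linarith
  have hd : HasGradientAt (fun y => supportFun K y - ⟪y, k⟫) (gradient (supportFun K) x - k) x := by
    rw [hasGradientAt_iff_hasFDerivAt, map_sub]
    refine hx.hasGradientAt.hasFDerivAt.fun_sub ?_
    have h2 := (InnerProductSpace.toDual ℝ (E n) k).hasFDerivAt (x := x)
    refine h2.congr_of_eventuallyEq (Filter.Eventually.of_forall fun y => ?_)
    simp [real_inner_comm]
  have h0 := hmin.hasFDerivAt_eq_zero hd.hasFDerivAt
  rw [map_eq_zero_iff _ (LinearIsometryEquiv.injective _), sub_eq_zero] at h0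
  exact h0

theorem norm_gradient_supportFun_le {K : ConvexBody (E n)} {R : ℝ} (hR0 : 0 ≤ R)
    (hR : ∀ k ∈ K, ‖k‖ ≤ R) (x : E n) : ‖gradient (supportFun K) x‖ ≤ R := by
  rw [gradient, LinearIsometryEquiv.norm_map]
  exact norm_fderiv_le_of_lipschitz ℝ (lipschitzWith_supportFun (R := ⟨R, hR0⟩) hR)

/-! ### Second order expansion of the Wills functional -/

/-- For `μ > 0`, the maximum over `k ∈ K` of `⟪x, k⟫ - μ ‖k‖² / 2`. -/
def penalizedSupport (K : ConvexBody (E n)) (μ : ℝ) (x : E n) : ℝ :=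
  (‖x‖ ^ 2 - Metric.infDist x ((μ • K : ConvexBody (E n)) : Set (E n)) ^ 2) / (2 * μ)

theorem norm_sub_smul_sq (x k : E n) (μ : ℝ) :
    ‖x - μ • k‖ ^ 2 = ‖x‖ ^ 2 - 2 * μ * (⟪x, k⟫ - μ * ‖k‖ ^ 2 / 2) := by
  rw [norm_sub_sq_real, real_inner_smul_right, norm_smul, mul_pow, Real.norm_eq_abs, sq_abs]
  ring

theorem le_penalizedSupport {K : ConvexBody (E n)} {μ : ℝ} (hμ : 0 < μ) {k : E n} (hk : k ∈ K)
    (x : E n) : ⟪x, k⟫ - μ * ‖k‖ ^ 2 / 2 ≤ penalizedSupport K μ x := by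
  rw [penalizedSupport, le_div_iff₀ (by positivity)]
  have hmem : μ • k ∈ ((μ • K : ConvexBody (E n)) : Set (E n)) := by
    rw [ConvexBody.coe_smul]; exact Set.smul_mem_smul_set hk
  have h := Metric.infDist_le_dist_of_mem hmem (x := x)
  rw [dist_eq_norm] at h
  have h2 := pow_le_pow_left₀ Metric.infDist_nonneg h 2
  rw [norm_sub_smul_sq] at h2
  linarith

/-- The maximizer is the `k` for which `μ k` is the point of `μ K` nearest to `x`. -/
theorem exists_eq_penalizedSupport (K : ConvexBody (E n)) {μ : ℝ} (hμ : 0 < μ) (x : E n) :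
    ∃ k ∈ K, penalizedSupport K μ x = ⟪x, k⟫ - μ * ‖k‖ ^ 2 / 2 := by
  have hmem := nearest_mem (μ • K) x
  rw [← SetLike.mem_coe, ConvexBody.coe_smul] at hmem
  obtain ⟨k, hk, h⟩ := hmem
  refine ⟨k, hk, ?_⟩
  rw [penalizedSupport, infDist_eq_norm_sub_nearest, ← h, norm_sub_smul_sq]
  field_simp
  ring

theorem penalizedSupport_le_supportFun (K : ConvexBody (E n)) {μ : ℝ} (hμ : 0 < μ) (x : E n) :
    penalizedSupport K μ x ≤ supportFun K x := by
  obtain ⟨k, hk, h⟩ := exists_eq_penalizedSupport K hμ x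
  rw [h]
  have := le_supportFun hk x
  have : 0 ≤ μ * ‖k‖ ^ 2 / 2 := by positivity
  linarith

theorem supportFun_sub_penalizedSupport_le {K : ConvexBody (E n)} {R : ℝ}
    (hR : ∀ k ∈ K, ‖k‖ ≤ R) {μ : ℝ} (hμ : 0 < μ) (x : E n) :
    supportFun K x - penalizedSupport K μ x ≤ μ * R ^ 2 / 2 := by
  obtain ⟨k, hk, h⟩ := exists_inner_eq_supportFun K x
  have h1 := le_penalizedSupport hμ hk x
  have h2 := pow_le_pow_left₀ (norm_nonneg k) (hR k hk) 2
  nlinarith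

theorem abs_penalizedSupport_le {K : ConvexBody (E n)} {R : ℝ}
    (hR : ∀ k ∈ K, ‖k‖ ≤ R) {μ : ℝ} (hμ : 0 < μ) (hμ1 : μ ≤ 1) (x : E n) :
    |penalizedSupport K μ x| ≤ R * ‖x‖ + R ^ 2 := by
  have h1 := penalizedSupport_le_supportFun K hμ x
  have h2 := supportFun_sub_penalizedSupport_le hR hμ x
  have h3 := abs_le.1 (abs_supportFun_le hR x)
  rw [abs_le]
  constructor <;> nlinarith [sq_nonneg R]

theorem continuous_penalizedSupport (K : ConvexBody (E n)) (μ : ℝ) :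
    Continuous (penalizedSupport K μ) := by
  unfold penalizedSupport
  have := Metric.continuous_infDist_pt ((μ • K : ConvexBody (E n)) : Set (E n))
  fun_prop

/-- Let `k = ∇h(x)`. Testing the maximum at `k` gives the lower bound. For the upper bound, the
maximizer `l` is tested in `h(x - μ k)` and `|l - k|² ≥ 0` is used; the resulting difference
quotient tends to `-|k|²`, to which `|k|²/2` is added. -/
theorem tendsto_supportFun_sub_penalizedSupport {K : ConvexBody (E n)} {x : E n}
    (hx : DifferentiableAt ℝ (supportFun K) x) :
    Tendsto (fun μ => (penalizedSupport K μ x - supportFun K x) / μ) (𝓝[>] 0)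
      (𝓝 (-‖gradient (supportFun K) x‖ ^ 2 / 2)) := by
  obtain ⟨k, hk, h⟩ := exists_inner_eq_supportFun K x
  rw [gradient_supportFun hx hk h]
  have hline := hx.hasGradientAt.hasFDerivAt.hasLineDerivAt (-k)
  rw [gradient_supportFun hx hk h] at hline
  have hslope := (hasLineDerivAt_iff_tendsto_slope_zero.1 hline).mono_left
    (nhdsWithin_mono 0 (s := Set.Ioi 0) fun t (ht : 0 < t) => ht.ne')
  have hup : Tendsto (fun t : ℝ => t⁻¹ • (supportFun K (x + t • -k) - supportFun K x) +
      ‖k‖ ^ 2 / 2) (𝓝[>] 0) (𝓝 (-‖k‖ ^ 2 / 2)) := by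
    have := hslope.add_const (‖k‖ ^ 2 / 2)
    convert this using 2
    simp
    ring
  refine tendsto_of_tendsto_of_tendsto_of_le_of_le' tendsto_const_nhds hup ?_ ?_
  · filter_upwards [self_mem_nhdsWithin] with μ hμ
    have hμ' : 0 < μ := hμ
    rw [le_div_iff₀ hμ']
    have := le_penalizedSupport hμ' hk x
    linarith
  · filter_upwards [self_mem_nhdsWithin] with μ hμ
    have hμ' : 0 < μ := hμ
    obtain ⟨l, hl, h'⟩ := exists_eq_penalizedSupport K hμ' x
    have h1 := le_supportFun hl (x + μ • -k)
    rw [div_le_iff₀ hμ', h', smul_eq_mul, add_mul, mul_right_comm,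
      inv_mul_cancel₀ hμ'.ne', one_mul]
    rw [inner_add_left, real_inner_smul_left, inner_neg_left] at h1
    have h2 : 0 ≤ ‖l - k‖ ^ 2 := sq_nonneg _
    rw [norm_sub_sq_real, real_inner_comm] at h2
    nlinarith

theorem abs_exp_sub_one_sub_id_le_mul (y : ℝ) :
    |Real.exp y - 1 - y| ≤ |y| ^ 2 * Real.exp |y| := by
  have h := Complex.norm_exp_sub_sum_le_norm_mul_exp (y : ℂ) 2
  rw [← Complex.ofReal_exp] at h
  simp only [Finset.sum_range_succ, Finset.sum_range_zero] at h
  rw [Complex.norm_real] at h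
  rw [← Real.norm_eq_abs, ← Complex.norm_real]
  convert h using 2
  · push_cast
    simp
    ring
  all_goals rw [Real.norm_eq_abs]

theorem abs_exp_sub_taylor_le_mul (y : ℝ) :
    |Real.exp y - 1 - y - y ^ 2 / 2| ≤ |y| ^ 3 * Real.exp |y| := by
  have h := Complex.norm_exp_sub_sum_le_norm_mul_exp (y : ℂ) 3
  rw [← Complex.ofReal_exp] at h
  simp only [Finset.sum_range_succ, Finset.sum_range_zero] at h
  rw [Complex.norm_real] at h
  rw [← Real.norm_eq_abs, ← Complex.norm_real]
  convert h using 2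
  · push_cast
    simp
    ring
  all_goals rw [Real.norm_eq_abs]

/-- Fernique's theorem makes some `exp (c |x|²)` integrable, and completing the square dominates `C
|x|`. -/
theorem integrable_exp_mul_norm (C : ℝ) :
    Integrable (fun x : E n => Real.exp (C * ‖x‖)) (gauss n) := by
  obtain ⟨c, hc, h⟩ := IsGaussian.exists_integrable_exp_sq (gauss n)
  refine (h.const_mul (Real.exp (C ^ 2 / (4 * c)))).mono' (by fun_prop) (ae_of_all _ fun x => ?_)
  rw [Real.norm_of_nonneg (Real.exp_pos _).le, ← Real.exp_add, Real.exp_le_exp]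
  have h2 : 0 ≤ c * (‖x‖ - C / (2 * c)) ^ 2 := by positivity
  have h3 : c * (‖x‖ - C / (2 * c)) ^ 2 = c * ‖x‖ ^ 2 - C * ‖x‖ + C ^ 2 / (4 * c) := by
    field_simp; ring
  linarith

theorem measurable_gradient (f : E n → ℝ) : Measurable (gradient f) :=
  (LinearIsometryEquiv.continuous _).measurable.comp (measurable_fderiv ℝ f)

theorem integrable_supportFun (K : ConvexBody (E n)) : Integrable (supportFun K) (gauss n) := by
  obtain ⟨R, hR0, hR⟩ := exists_norm_le K
  obtain ⟨C, hC⟩ := exists_lipschitzWith_supportFun K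
  refine ((IsGaussian.integrable_id (μ := gauss n)).norm.const_mul R).mono'
    hC.continuous.aestronglyMeasurable (ae_of_all _ fun x => ?_)
  simpa using abs_supportFun_le hR x

theorem integrable_supportFun_sq (K : ConvexBody (E n)) :
    Integrable (fun x => supportFun K x ^ 2) (gauss n) := by
  obtain ⟨R, hR0, hR⟩ := exists_norm_le K
  obtain ⟨C, hC⟩ := exists_lipschitzWith_supportFun K
  have h2 : Integrable (fun x : E n => ‖x‖ ^ 2) (gauss n) :=
    (IsGaussian.memLp_two_id (μ := gauss n)).integrable_norm_pow two_ne_zero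
  refine (h2.const_mul (R ^ 2)).mono' (hC.continuous.pow 2).aestronglyMeasurable
    (ae_of_all _ fun x => ?_)
  rw [Real.norm_eq_abs, abs_pow, ← mul_pow]
  exact pow_le_pow_left₀ (abs_nonneg _) (abs_supportFun_le hR x) 2

theorem integrable_norm_gradient_sq (K : ConvexBody (E n)) :
    Integrable (fun x => ‖gradient (supportFun K) x‖ ^ 2) (gauss n) := by
  obtain ⟨R, hR0, hR⟩ := exists_norm_le K
  refine (integrable_const (R ^ 2)).mono'
    ((measurable_gradient _).norm.pow_const 2).aestronglyMeasurable (ae_of_all _ fun x => ?_)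
  rw [Real.norm_of_nonneg (sq_nonneg _)]
  exact pow_le_pow_left₀ (norm_nonneg _) (norm_gradient_supportFun_le hR0 hR x) 2

/-- Pointwise, `exp (μ p_μ) - 1 - μ h = μ (p_μ - h) + (μ p_μ)²/2 + o(μ²)`, where `p_μ` is the
penalized support function. The first term contributes `-|∇h|²/2` and the second `h²/2`; dominated
convergence does the rest. -/
theorem tendsto_integral_exp_penalizedSupport (K : ConvexBody (E n)) :
    Tendsto (fun μ => ((∫ x, Real.exp (μ * penalizedSupport K μ x) ∂gauss n) - 1 -
        μ * ∫ x, supportFun K x ∂gauss n) / μ ^ 2) (𝓝[>] 0)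
      (𝓝 (((∫ x, supportFun K x ^ 2 ∂gauss n) -
        ∫ x, ‖gradient (supportFun K) x‖ ^ 2 ∂gauss n) / 2)) := by
  obtain ⟨R, hR0, hR⟩ := exists_norm_le K
  obtain ⟨C, hC⟩ := exists_lipschitzWith_supportFun K
  have hsmall : ∀ᶠ μ : ℝ in 𝓝[>] 0, 0 < μ ∧ μ ≤ 1 := by
    filter_upwards [Ioc_mem_nhdsGT one_pos] with μ hμ using hμ
  have hb : ∀ μ : ℝ, 0 < μ ∧ μ ≤ 1 → ∀ x, |μ * penalizedSupport K μ x| ≤ μ * (R * ‖x‖ + R ^ 2) := by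
    intro μ hμ x
    rw [abs_mul, abs_of_pos hμ.1]
    exact mul_le_mul_of_nonneg_left (abs_penalizedSupport_le hR hμ.1 hμ.2 x) hμ.1.le
  have hb' : ∀ μ : ℝ, 0 < μ ∧ μ ≤ 1 → ∀ x, |μ * penalizedSupport K μ x| ≤ R * ‖x‖ + R ^ 2 := by
    intro μ hμ x
    refine (hb μ hμ x).trans ?_
    have : 0 ≤ R * ‖x‖ + R ^ 2 := by positivity
    nlinarith [hμ.2]
  have hae : ∀ᵐ x ∂gauss n, DifferentiableAt ℝ (supportFun K) x :=
    gauss_absolutelyContinuous.ae_le hC.ae_differentiableAt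
  have hlim := tendsto_integral_filter_of_dominated_convergence (μ := gauss n)
    (l := 𝓝[>] (0 : ℝ))
    (F := fun μ x => (Real.exp (μ * penalizedSupport K μ x) - 1 - μ * supportFun K x) / μ ^ 2)
    (f := fun x => (supportFun K x ^ 2 - ‖gradient (supportFun K) x‖ ^ 2) / 2)
    -- With `a = R |x| + R²` bounding `|p_μ|`, the exponential remainder over `μ²` is at most `a²
    -- exp a ≤ 2 exp (2a)`; the term `R²/2` bounds `(h - p_μ) / μ`.
    (fun x => 2 * Real.exp (2 * R ^ 2) * Real.exp (2 * R * ‖x‖) + R ^ 2 / 2) ?_ ?_ ?_ ?_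
  · have e : ∫ x, (supportFun K x ^ 2 - ‖gradient (supportFun K) x‖ ^ 2) / 2 ∂gauss n =
      ((∫ x, supportFun K x ^ 2 ∂gauss n) -
        ∫ x, ‖gradient (supportFun K) x‖ ^ 2 ∂gauss n) / 2 := by
      rw [integral_div, integral_sub (integrable_supportFun_sq K) (integrable_norm_gradient_sq K)]
    rw [← e]
    refine hlim.congr' ?_
    filter_upwards [hsmall] with μ hμ
    have hint : Integrable (fun x => Real.exp (μ * penalizedSupport K μ x)) (gauss n) := by
      refine ((integrable_exp_mul_norm R).const_mul (Real.exp (R ^ 2))).mono' ?_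
        (ae_of_all _ fun x => ?_)
      · exact (Real.continuous_exp.comp
          ((continuous_penalizedSupport K μ).const_mul μ)).aestronglyMeasurable
      · rw [Real.norm_of_nonneg (Real.exp_pos _).le, ← Real.exp_add, Real.exp_le_exp, add_comm]
        exact (le_abs_self _).trans (hb' μ hμ x)
    rw [integral_div, integral_sub (by exact hint.sub (integrable_const 1))
      ((integrable_supportFun K).const_mul μ), integral_sub hint (integrable_const 1),
      integral_const_mul]
    simp
  · filter_upwards with μ
    have h1 := continuous_penalizedSupport K μ
    have h2 := hC.continuous
    exact Continuous.aestronglyMeasurable (by fun_prop)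
  · filter_upwards [hsmall] with μ hμ
    refine ae_of_all _ fun x => ?_
    set s := penalizedSupport K μ x
    set a := R * ‖x‖ + R ^ 2 with ha
    have ha0 : 0 ≤ a := by positivity
    have h1 : |Real.exp (μ * s) - 1 - μ * s| ≤ μ ^ 2 * (2 * Real.exp (2 * a)) := by
      refine (abs_exp_sub_one_sub_id_le_mul _).trans ?_
      have h2 : |μ * s| ^ 2 ≤ (μ * a) ^ 2 := pow_le_pow_left₀ (abs_nonneg _) (hb μ hμ x) 2
      have h3 : Real.exp |μ * s| ≤ Real.exp a := Real.exp_le_exp.2 (hb' μ hμ x)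
      have h4 : a ^ 2 ≤ 2 * Real.exp a := by
        have := Real.quadratic_le_exp_of_nonneg ha0
        nlinarith
      calc |μ * s| ^ 2 * Real.exp |μ * s| ≤ (μ * a) ^ 2 * Real.exp a := by gcongr
        _ = μ ^ 2 * (a ^ 2 * Real.exp a) := by ring
        _ ≤ μ ^ 2 * ((2 * Real.exp a) * Real.exp a) := by gcongr
        _ = _ := by rw [mul_assoc, ← Real.exp_add]; ring_nf
    have h5 := penalizedSupport_le_supportFun K hμ.1 x
    have h6 := supportFun_sub_penalizedSupport_le hR hμ.1 x
    have h7 : |μ * s - μ * supportFun K x| ≤ μ ^ 2 * (R ^ 2 / 2) := by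
      rw [abs_le]; constructor <;> nlinarith [hμ.1, sq_nonneg R, mul_pos hμ.1 hμ.1]
    have h8 : Real.exp (2 * a) = Real.exp (2 * R ^ 2) * Real.exp (2 * R * ‖x‖) := by
      rw [← Real.exp_add, ha]; ring_nf
    rw [norm_div, Real.norm_of_nonneg (sq_nonneg μ), div_le_iff₀ (pow_pos hμ.1 2),
      Real.norm_eq_abs]
    calc |Real.exp (μ * s) - 1 - μ * supportFun K x|
        = |(Real.exp (μ * s) - 1 - μ * s) + (μ * s - μ * supportFun K x)| := by congr 1; ring
      _ ≤ _ := abs_add_le _ _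
      _ ≤ μ ^ 2 * (2 * Real.exp (2 * a)) + μ ^ 2 * (R ^ 2 / 2) := add_le_add h1 h7
      _ = _ := by rw [h8]; ring
  · exact (((integrable_exp_mul_norm (2 * R)).const_mul _)).add (integrable_const _)
  · filter_upwards [hae] with x hx
    have hg := tendsto_supportFun_sub_penalizedSupport hx
    have hid : Tendsto (fun μ : ℝ => μ) (𝓝[>] 0) (𝓝 0) := tendsto_nhdsWithin_of_tendsto_nhds tendsto_id
    have hs : Tendsto (fun μ => penalizedSupport K μ x) (𝓝[>] 0) (𝓝 (supportFun K x)) := by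
      have := (hg.mul hid).add_const (supportFun K x)
      rw [mul_zero, zero_add] at this
      refine this.congr' ?_
      filter_upwards [hsmall] with μ hμ
      rw [div_mul_cancel₀ _ hμ.1.ne']; ring
    have hq : Tendsto (fun μ => (Real.exp (μ * penalizedSupport K μ x) - 1 -
        μ * penalizedSupport K μ x - (μ * penalizedSupport K μ x) ^ 2 / 2) / μ ^ 2)
        (𝓝[>] 0) (𝓝 0) := by
      have hz : Tendsto (fun μ => μ * (|penalizedSupport K μ x| ^ 3 *
          Real.exp |μ * penalizedSupport K μ x|)) (𝓝[>] 0) (𝓝 0) := by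
        have := hid.mul ((hs.abs.pow 3).mul ((Real.continuous_exp.tendsto _).comp
          ((hid.mul hs).abs)))
        simpa using this
      refine squeeze_zero_norm' ?_ hz
      filter_upwards [hsmall] with μ hμ
      rw [norm_div, Real.norm_of_nonneg (sq_nonneg μ), div_le_iff₀ (pow_pos hμ.1 2),
        Real.norm_eq_abs]
      refine (abs_exp_sub_taylor_le_mul _).trans_eq ?_
      rw [abs_mul μ, abs_of_pos hμ.1]; ring
    have hsum := (hq.add ((hs.pow 2).div_const 2)).add hg
    have e : 0 + supportFun K x ^ 2 / 2 + -‖gradient (supportFun K) x‖ ^ 2 / 2 =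
      (supportFun K x ^ 2 - ‖gradient (supportFun K) x‖ ^ 2) / 2 := by ring
    rw [e] at hsum
    refine hsum.congr' ?_
    filter_upwards [hsmall] with μ hμ
    have := hμ.1.ne'
    field_simp
    ring

/-! ### Gaussian formulas for the first intrinsic volumes -/

theorem Polynomial.coeff_eq_of_tendsto {P : Polynomial ℝ} {e L : ℝ}
    (h : Tendsto (fun μ => (P.eval μ - 1 - μ * e) / μ ^ 2) (𝓝[>] 0) (𝓝 L)) :
    P.coeff 0 = 1 ∧ P.coeff 1 = e ∧ P.coeff 2 = L := by
  have hid : Tendsto (fun μ : ℝ => μ) (𝓝[>] 0) (𝓝 0) :=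
    tendsto_nhdsWithin_of_tendsto_nhds tendsto_id
  have key : ∀ (Q : Polynomial ℝ) (f : ℝ → ℝ) (l : ℝ), Tendsto f (𝓝[>] 0) (𝓝 l) →
      (∀ μ, 0 < μ → Q.eval μ = f μ) → Q.coeff 0 = l := by
    intro Q f l hf hQ
    rw [Polynomial.coeff_zero_eq_eval_zero]
    refine tendsto_nhds_unique (f := fun μ => Q.eval μ) (l := 𝓝[>] 0) ?_
      (hf.congr' ?_)
    · exact (Q.continuous.tendsto 0).mono_left nhdsWithin_le_nhds
    · filter_upwards [self_mem_nhdsWithin] with μ hμ using (hQ μ hμ).symm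
  have hdiv : ∀ (Q : Polynomial ℝ) (μ : ℝ), 0 < μ →
      Q.divX.eval μ = (Q.eval μ - Q.coeff 0) / μ := by
    intro Q μ hμ
    rw [eq_div_iff hμ.ne']
    conv_rhs => rw [← Polynomial.divX_mul_X_add Q]
    simp
  have h0 : P.coeff 0 = 1 := by
    refine key P (fun μ => (P.eval μ - 1 - μ * e) / μ ^ 2 * μ ^ 2 + 1 + μ * e) 1 ?_ ?_
    · simpa using ((h.mul (hid.pow 2)).add_const 1).add (hid.mul_const e)
    · intro μ hμ
      have := hμ.ne'
      field_simp; ring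
  have h1 : P.divX.coeff 0 = e := by
    refine key _ (fun μ => (P.eval μ - 1 - μ * e) / μ ^ 2 * μ + e) e ?_ ?_
    · simpa using (h.mul hid).add_const e
    · intro μ hμ
      rw [hdiv P μ hμ, h0]
      have := hμ.ne'
      field_simp; ring
  have h2 : P.divX.divX.coeff 0 = L := by
    refine key _ _ L h ?_
    intro μ hμ
    rw [hdiv _ μ hμ, hdiv P μ hμ, h0, h1]
    have := hμ.ne'
    field_simp
  simp only [Polynomial.coeff_divX] at h1 h2
  exact ⟨h0, h1, h2⟩

theorem integral_exp_penalizedSupport (K : ConvexBody (E n)) {μ : ℝ} (hμ : 0 < μ) :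
    ∫ x, Real.exp (μ * penalizedSupport K μ x) ∂gauss n =
      ∑ i ∈ Finset.range (n + 1), intrinsicVolume i K / √(2 * Real.pi) ^ i * μ ^ i := by
  have h := integral_gauss_exp_infDist (μ • K)
  simp_rw [intrinsicVolume_smul K hμ] at h
  have e : ∀ x : E n, μ * penalizedSupport K μ x =
      (‖x‖ ^ 2 - Metric.infDist x ((μ • K : ConvexBody (E n)) : Set (E n)) ^ 2) / 2 := fun x => by
    rw [penalizedSupport]; field_simp
  simp_rw [e]
  rw [h]
  exact Finset.sum_congr rfl fun i _ => by ring

theorem intrinsicVolume_eq_zero (K : ConvexBody (E n)) {i : ℕ} (hi : n < i) :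
    intrinsicVolume i K = 0 :=
  (isSteinerCoeff_intrinsicVolume K).1 i hi

/-- The polynomial with coefficients `V_i / √(2π)^i` is the Wills functional of `μ K`; its
coefficients of degree at most two are read off from the expansion at `μ = 0`. -/
theorem intrinsicVolume_low (K : ConvexBody (E n)) :
    intrinsicVolume 0 K = 1 ∧
    intrinsicVolume 1 K = √(2 * Real.pi) * ∫ x, supportFun K x ∂gauss n ∧
    intrinsicVolume 2 K = Real.pi * ((∫ x, supportFun K x ^ 2 ∂gauss n) -
        ∫ x, ‖gradient (supportFun K) x‖ ^ 2 ∂gauss n) := by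
  let P : Polynomial ℝ := ∑ i ∈ Finset.range (n + 1),
    Polynomial.monomial i (intrinsicVolume i K / √(2 * Real.pi) ^ i)
  have hcoeff : ∀ i, P.coeff i = intrinsicVolume i K / √(2 * Real.pi) ^ i := by
    intro i
    simp only [P, Polynomial.finsetSum_coeff, Polynomial.coeff_monomial]
    by_cases hi : i ≤ n
    · simp [Nat.lt_succ_of_le hi]
    · rw [intrinsicVolume_eq_zero K (by omega), zero_div]
      refine Finset.sum_eq_zero fun j hj => ?_
      have := Finset.mem_range.1 hj
      rw [if_neg (by omega)]
  have h := tendsto_integral_exp_penalizedSupport K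
  obtain ⟨h0, h1, h2⟩ := Polynomial.coeff_eq_of_tendsto (P := P)
    (e := ∫ x, supportFun K x ∂gauss n) (h.congr' (by
    filter_upwards [self_mem_nhdsWithin] with μ hμ
    rw [integral_exp_penalizedSupport K hμ]
    simp [P, Polynomial.eval_finsetSum]))
  rw [hcoeff] at h0 h1 h2
  have hpi : 0 < √(2 * Real.pi) := by positivity
  refine ⟨by simpa using h0, ?_, ?_⟩
  · rw [← h1]; field_simp
  · rw [Real.sq_sqrt (by positivity)] at h2
    field_simp at h2
    linarith

/-! ### The Gaussian Poincaré inequality -/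

theorem norm_le_of_lipschitzWith {C : NNReal} {g : E n → ℝ} (hg : LipschitzWith C g) (x : E n) :
    ‖g x‖ ≤ ‖g 0‖ + C * ‖x‖ := by
  have h := hg.norm_sub_le x 0
  rw [sub_zero] at h
  have h2 := norm_le_insert' (g x) (g 0)
  linarith

theorem memLp_gauss_of_lipschitzWith {C : NNReal} {g : E n → ℝ} (hg : LipschitzWith C g) :
    MemLp g 2 (gauss n) := by
  have h0 : MemLp (fun x : E n => ‖x‖) 2 (gauss n) :=
    (IsGaussian.memLp_two_id (μ := gauss n)).norm
  have h1 : MemLp (fun x : E n => ‖g 0‖ + C * ‖x‖) 2 (gauss n) :=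
    MemLp.add (memLp_const _) (h0.const_mul (C : ℝ))
  refine h1.mono hg.continuous.aestronglyMeasurable (ae_of_all _ fun x => ?_)
  exact (norm_le_of_lipschitzWith hg x).trans (le_abs_self _)

theorem ae_differentiableAt_gauss {C : NNReal} {g : E n → ℝ} (hg : LipschitzWith C g) :
    ∀ᵐ x ∂gauss n, DifferentiableAt ℝ g x :=
  gauss_absolutelyContinuous.ae_le hg.ae_differentiableAt

theorem norm_gradient_le {C : NNReal} {g : E n → ℝ} (hg : LipschitzWith C g) (x : E n) :
    ‖gradient g x‖ ≤ C := by
  rw [gradient, LinearIsometryEquiv.norm_map]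
  exact norm_fderiv_le_of_lipschitz ℝ hg

/-- The Cameron–Martin formula. -/
theorem integral_gauss_add (g : E n → ℝ) (w : E n) :
    ∫ y, g (y + w) ∂gauss n = ∫ y, g y * Real.exp (⟪y, w⟫ - ‖w‖ ^ 2 / 2) ∂gauss n := by
  rw [integral_gauss, integral_gauss,
    ← integral_sub_right_eq_self (fun y => gaussDensity n y * g (y + w)) w]
  refine integral_congr_ae (ae_of_all _ fun y => ?_)
  simp only [sub_add_cancel, gaussDensity]
  rw [norm_sub_sq_real, mul_comm (g y), mul_assoc, mul_assoc, ← mul_assoc (Real.exp _),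
    ← Real.exp_add]
  congr 3
  ring

/-- Gaussian integration by parts. -/
theorem integral_gauss_mul_inner {C : NNReal} {g : E n → ℝ} (hg : LipschitzWith C g) {v : E n}
    {D : E n → ℝ} (hDm : AEStronglyMeasurable D (gauss n))
    (hD : ∀ᵐ y ∂gauss n, HasLineDerivAt ℝ g (D y) y v) :
    ∫ y, g y * ⟪y, v⟫ ∂gauss n = ∫ y, D y ∂gauss n := by
  -- The function `t ↦ E g(y + t v)` is differentiated at `0` twice: directly, and after
  -- Cameron–Martin has moved the shift into the density. Uniqueness of the derivative gives the
  -- formula.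
  have h1 := (hasDerivAt_integral_of_dominated_loc_of_lip (μ := gauss n) (𝕜 := ℝ) (x₀ := 0)
    (F := fun t y => g (y + t • v)) (F' := D) (bound := fun _ => C * ‖v‖) (s := Set.univ)
    univ_mem ?_ ?_ hDm ?_ (integrable_const _) hD).2
  · have h2 := (hasDerivAt_integral_of_dominated_loc_of_deriv_le (μ := gauss n) (𝕜 := ℝ) (x₀ := 0)
      (F := fun t y => g y * Real.exp (⟪y, t • v⟫ - ‖t • v‖ ^ 2 / 2))
      (F' := fun t y => g y * (Real.exp (⟪y, t • v⟫ - ‖t • v‖ ^ 2 / 2) *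
        (⟪y, v⟫ - t * ‖v‖ ^ 2)))
      -- For `|t| < 1`, the growth of `g` and the linear factor each cost `exp ‖y‖`, and the
      -- Cameron–Martin density costs `exp (‖v‖ ‖y‖)`.
      (bound := fun y => (‖g 0‖ + C) * (‖v‖ + ‖v‖ ^ 2) * Real.exp ((2 + ‖v‖) * ‖y‖))
      (s := Metric.ball 0 1) (Metric.ball_mem_nhds _ one_pos) ?_ ?_ ?_ ?_
      ((integrable_exp_mul_norm _).const_mul _) ?_).2
    · have h3 : (fun t : ℝ => ∫ y, g (y + t • v) ∂gauss n) =
          fun t => ∫ y, g y * Real.exp (⟪y, t • v⟫ - ‖t • v‖ ^ 2 / 2) ∂gauss n :=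
        funext fun t => integral_gauss_add g (t • v)
      rw [h3] at h1
      have := h2.unique h1
      simpa using this
    · have := hg.continuous
      exact Filter.Eventually.of_forall fun t => Continuous.aestronglyMeasurable (by fun_prop)
    · simpa using (memLp_gauss_of_lipschitzWith hg).integrable one_le_two
    · have := hg.continuous
      exact Continuous.aestronglyMeasurable (by fun_prop)
    · refine ae_of_all _ fun y t ht => ?_
      have ht' : |t| ≤ 1 := by simpa using (Metric.mem_ball.1 ht).le
      have hy : ‖y‖ ≤ Real.exp ‖y‖ := by linarith [Real.add_one_le_exp ‖y‖]
      have hy1 : 1 ≤ Real.exp ‖y‖ := Real.one_le_exp (norm_nonneg y)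
      have hv0 := norm_nonneg v
      have e1 : ‖g y‖ ≤ (‖g 0‖ + C) * Real.exp ‖y‖ := by
        refine (norm_le_of_lipschitzWith hg y).trans ?_
        rw [add_mul]
        gcongr
        exact le_mul_of_one_le_right (norm_nonneg _) hy1
      have hin : |⟪y, v⟫| ≤ ‖y‖ * ‖v‖ := abs_real_inner_le_norm _ _
      have e2 : |⟪y, v⟫ - t * ‖v‖ ^ 2| ≤ (‖v‖ + ‖v‖ ^ 2) * Real.exp ‖y‖ := by
        calc |⟪y, v⟫ - t * ‖v‖ ^ 2| ≤ |⟪y, v⟫| + |t * ‖v‖ ^ 2| := abs_sub _ _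
          _ ≤ ‖y‖ * ‖v‖ + 1 * ‖v‖ ^ 2 := by
              rw [abs_mul, abs_of_nonneg (sq_nonneg ‖v‖)]
              gcongr
          _ ≤ Real.exp ‖y‖ * ‖v‖ + Real.exp ‖y‖ * ‖v‖ ^ 2 := by gcongr
          _ = _ := by ring
      have e3 : Real.exp (⟪y, t • v⟫ - ‖t • v‖ ^ 2 / 2) ≤ Real.exp (‖v‖ * ‖y‖) := by
        rw [Real.exp_le_exp, real_inner_smul_right]
        have : t * ⟪y, v⟫ ≤ |t| * |⟪y, v⟫| := by rw [← abs_mul]; exact le_abs_self _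
        have h4 : |t| * |⟪y, v⟫| ≤ 1 * (‖y‖ * ‖v‖) := by gcongr
        nlinarith [sq_nonneg ‖t • v‖]
      rw [norm_mul, norm_mul, Real.norm_of_nonneg (Real.exp_pos _).le, Real.norm_eq_abs (_ - _)]
      calc _ ≤ ((‖g 0‖ + C) * Real.exp ‖y‖) * (Real.exp (‖v‖ * ‖y‖) *
            ((‖v‖ + ‖v‖ ^ 2) * Real.exp ‖y‖)) := by gcongr
        _ = (‖g 0‖ + C) * (‖v‖ + ‖v‖ ^ 2) *
            (Real.exp ‖y‖ * Real.exp ‖y‖ * Real.exp (‖v‖ * ‖y‖)) := by ring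
        _ = _ := by
            rw [← Real.exp_add, ← Real.exp_add]
            congr 2; ring
    · refine ae_of_all _ fun y t _ => ?_
      have e : (fun t : ℝ => g y * Real.exp (⟪y, t • v⟫ - ‖t • v‖ ^ 2 / 2)) =
          fun t => g y * Real.exp (t * ⟪y, v⟫ - t ^ 2 * ‖v‖ ^ 2 / 2) := by
        funext t
        rw [real_inner_smul_right, norm_smul, mul_pow, Real.norm_eq_abs, sq_abs]
      rw [e]
      have hd := ((hasDerivAt_id t).mul_const ⟪y, v⟫).sub
        (((hasDerivAt_pow 2 t).mul_const (‖v‖ ^ 2)).div_const 2)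
      refine (hd.exp.const_mul (g y)).congr_deriv ?_
      rw [real_inner_smul_right, norm_smul, mul_pow, Real.norm_eq_abs, sq_abs]
      simp
      ring_nf
      simp
  · have := hg.continuous
    exact Filter.Eventually.of_forall fun t => Continuous.aestronglyMeasurable (by fun_prop)
  · simpa using (memLp_gauss_of_lipschitzWith hg).integrable one_le_two
  · refine ae_of_all _ fun y => LipschitzOnWith.of_dist_le_mul fun t _ t' _ => ?_
    refine (hg.dist_le_mul _ _).trans_eq ?_
    rw [Real.coe_nnabs, abs_of_nonneg (by positivity), dist_eq_norm, dist_eq_norm,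
      add_sub_add_left_eq_sub, ← sub_smul, norm_smul]
    ring

/-! ### Interpolation by rotating two independent Gaussian vectors -/

theorem measurePreserving_rotation (n : ℕ) (θ : ℝ) :
    MeasurePreserving (ContinuousLinearMap.rotation θ : E n × E n →L[ℝ] E n × E n)
      ((gauss n).prod (gauss n)) ((gauss n).prod (gauss n)) :=
  ⟨by fun_prop, IsGaussian.map_rotation_eq_self (by simp) θ⟩

theorem measurePreserving_rotation_fst (n : ℕ) (θ : ℝ) :
    MeasurePreserving (fun p : E n × E n => Real.cos θ • p.1 + Real.sin θ • p.2)
      ((gauss n).prod (gauss n)) (gauss n) :=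
  measurePreserving_fst.comp (measurePreserving_rotation n θ)

theorem integrable_norm_gradient_sq_of_lipschitzWith {C : NNReal} {f : E n → ℝ}
    (hf : LipschitzWith C f) : Integrable (fun x => ‖gradient f x‖ ^ 2) (gauss n) := by
  refine (integrable_const ((C : ℝ) ^ 2)).mono'
    ((measurable_gradient _).norm.pow_const 2).aestronglyMeasurable (ae_of_all _ fun x => ?_)
  rw [Real.norm_of_nonneg (sq_nonneg _)]
  exact pow_le_pow_left₀ (norm_nonneg _) (norm_gradient_le hf x) 2

/-- The covariance of `f` along the Ornstein–Uhlenbeck interpolation. -/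
def interpolation (f : E n → ℝ) (θ : ℝ) : ℝ :=
  ∫ p, f p.1 * f (Real.cos θ • p.1 + Real.sin θ • p.2) ∂(gauss n).prod (gauss n)

theorem hasDerivAt_interpolation {C : NNReal} {f : E n → ℝ} (hf : LipschitzWith C f) (θ : ℝ) :
    Integrable (fun p : E n × E n =>
      f p.1 * ⟪gradient f (Real.cos θ • p.1 + Real.sin θ • p.2),
        -Real.sin θ • p.1 + Real.cos θ • p.2⟫) ((gauss n).prod (gauss n)) ∧
    HasDerivAt (interpolation f) (∫ p : E n × E n,
      f p.1 * ⟪gradient f (Real.cos θ • p.1 + Real.sin θ • p.2),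
        -Real.sin θ • p.1 + Real.cos θ • p.2⟫ ∂(gauss n).prod (gauss n)) θ := by
  have hc := hf.continuous
  have hL2 := memLp_gauss_of_lipschitzWith hf
  have hL2' : MemLp (fun p : E n × E n => f p.1) 2 ((gauss n).prod (gauss n)) :=
    hL2.comp_measurePreserving measurePreserving_fst
  have hN1 : MemLp (fun p : E n × E n => ‖p.1‖) 2 ((gauss n).prod (gauss n)) :=
    (IsGaussian.memLp_two_id (μ := gauss n)).norm.comp_measurePreserving measurePreserving_fst
  have hN2 : MemLp (fun p : E n × E n => ‖p.2‖) 2 ((gauss n).prod (gauss n)) :=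
    (IsGaussian.memLp_two_id (μ := gauss n)).norm.comp_measurePreserving measurePreserving_snd
  refine hasDerivAt_integral_of_dominated_loc_of_lip (s := Set.univ)
    (bound := fun p => ‖f p.1‖ * (C * (‖p.1‖ + ‖p.2‖))) univ_mem ?_ ?_ ?_ ?_ ?_ ?_
  · exact Filter.Eventually.of_forall fun t => Continuous.aestronglyMeasurable (by fun_prop)
  · exact hL2'.integrable_mul (hL2.comp_measurePreserving (measurePreserving_rotation_fst n θ))
  · refine Measurable.aestronglyMeasurable ?_
    have := measurable_gradient f
    have h2 : Measurable fun p : E n × E n =>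
      gradient f (Real.cos θ • p.1 + Real.sin θ • p.2) := this.comp (by fun_prop)
    exact (hc.measurable.comp measurable_fst).mul (h2.inner (by fun_prop))
  · refine ae_of_all _ fun p => LipschitzOnWith.of_dist_le_mul fun t _ t' _ => ?_
    have h1 := hf.norm_sub_le (Real.cos t • p.1 + Real.sin t • p.2)
      (Real.cos t' • p.1 + Real.sin t' • p.2)
    rw [Real.coe_nnabs, abs_of_nonneg (by positivity), dist_eq_norm, dist_eq_norm, ← mul_sub,
      norm_mul, mul_assoc]
    refine mul_le_mul_of_nonneg_left (h1.trans ?_) (norm_nonneg _)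
    rw [mul_assoc]
    refine mul_le_mul_of_nonneg_left ?_ C.2
    have h2 : Real.cos t • p.1 + Real.sin t • p.2 - (Real.cos t' • p.1 + Real.sin t' • p.2) =
      (Real.cos t - Real.cos t') • p.1 + (Real.sin t - Real.sin t') • p.2 := by module
    rw [h2]
    refine (norm_add_le _ _).trans ?_
    rw [norm_smul, norm_smul, add_mul, mul_comm ‖p.1‖, mul_comm ‖p.2‖]
    have hcos : ‖Real.cos t - Real.cos t'‖ ≤ ‖t - t'‖ := Real.abs_cos_sub_cos_le t t'
    have hsin : ‖Real.sin t - Real.sin t'‖ ≤ ‖t - t'‖ := Real.abs_sin_sub_sin_le t t'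
    gcongr
  · exact hL2'.norm.integrable_mul ((hN1.add hN2).const_mul (C : ℝ))
  · have hae : ∀ᵐ p ∂(gauss n).prod (gauss n),
        DifferentiableAt ℝ f (Real.cos θ • p.1 + Real.sin θ • p.2) :=
      (measurePreserving_rotation_fst n θ).quasiMeasurePreserving.ae
        (ae_differentiableAt_gauss hf)
    filter_upwards [hae] with p hp
    have h1 : HasDerivAt (fun t => Real.cos t • p.1 + Real.sin t • p.2)
        (-Real.sin θ • p.1 + Real.cos θ • p.2) θ :=
      ((Real.hasDerivAt_cos θ).smul_const p.1).add ((Real.hasDerivAt_sin θ).smul_const p.2)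
    have h2 := hp.hasGradientAt.hasFDerivAt.comp_hasDerivAt θ h1
    exact h2.const_mul (f p.1)

theorem measurable_inner_gradient (f : E n → ℝ) (θ : ℝ) :
    Measurable fun p : E n × E n => ⟪gradient f p.1,
      gradient f (Real.cos θ • p.1 - Real.sin θ • p.2)⟫ :=
  ((measurable_gradient f).comp measurable_fst).inner
    ((measurable_gradient f).comp (by fun_prop))

theorem integrable_inner_gradient {C : NNReal} {f : E n → ℝ} (hf : LipschitzWith C f) (θ : ℝ) :
    Integrable (fun p : E n × E n => ⟪gradient f p.1,
      gradient f (Real.cos θ • p.1 - Real.sin θ • p.2)⟫) ((gauss n).prod (gauss n)) := by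
  refine (integrable_const ((C : ℝ) * C)).mono'
    (measurable_inner_gradient f θ).aestronglyMeasurable (ae_of_all _ fun p => ?_)
  refine (norm_inner_le_norm _ _).trans ?_
  gcongr
  · exact norm_gradient_le hf _
  · exact norm_gradient_le hf _

/-- In rotated coordinates, which are again independent Gaussians, the integrand is `f(cos θ q₁ -
sin θ q₂) ⟪∇f(q₁), q₂⟫`. Integration by parts in `q₂`, with `q₁` fixed, replaces `q₂` by `-sin θ
∇f`, so only first derivatives of `f` appear. -/
theorem interpolation_deriv_eq {C : NNReal} {f : E n → ℝ} (hf : LipschitzWith C f) (θ : ℝ) :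
    ∫ p : E n × E n, f p.1 * ⟪gradient f (Real.cos θ • p.1 + Real.sin θ • p.2),
        -Real.sin θ • p.1 + Real.cos θ • p.2⟫ ∂(gauss n).prod (gauss n) =
      -Real.sin θ * ∫ p : E n × E n, ⟪gradient f p.1,
        gradient f (Real.cos θ • p.1 - Real.sin θ • p.2)⟫ ∂(gauss n).prod (gauss n) := by
  have hc := hf.continuous
  let H : E n × E n → ℝ := fun q =>
    f (Real.cos θ • q.1 - Real.sin θ • q.2) * ⟪gradient f q.1, q.2⟫
  have hH : ∀ p : E n × E n, f p.1 * ⟪gradient f (Real.cos θ • p.1 + Real.sin θ • p.2),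
      -Real.sin θ • p.1 + Real.cos θ • p.2⟫ = H (ContinuousLinearMap.rotation θ p) := by
    intro p
    simp only [H, ContinuousLinearMap.rotation_apply]
    congr 2
    have : Real.cos θ • (Real.cos θ • p.1 + Real.sin θ • p.2) -
        Real.sin θ • (-Real.sin θ • p.1 + Real.cos θ • p.2) =
        (Real.cos θ ^ 2 + Real.sin θ ^ 2) • p.1 := by module
    rw [this, Real.cos_sq_add_sin_sq, one_smul]
  have hHm : Measurable H :=
    (hc.measurable.comp (by fun_prop)).mul
      (((measurable_gradient f).comp measurable_fst).inner measurable_snd)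
  have hHint : Integrable H ((gauss n).prod (gauss n)) := by
    have := (hasDerivAt_interpolation hf θ).1
    simp_rw [hH] at this
    exact ((measurePreserving_rotation n θ).integrable_comp hHm.aestronglyMeasurable).1 this
  have hGm := measurable_inner_gradient f θ
  have hGint := integrable_inner_gradient hf θ
  have hae : ∀ᵐ x ∂gauss n, ∀ᵐ y ∂gauss n,
      DifferentiableAt ℝ f (Real.cos θ • x - Real.sin θ • y) := by
    have := (measurePreserving_rotation_fst n (-θ)).quasiMeasurePreserving.ae
        (ae_differentiableAt_gauss hf)
    simp only [Real.cos_neg, Real.sin_neg, neg_smul, ← sub_eq_add_neg] at this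
    exact Measure.ae_ae_of_ae_prod this
  have hrot : ∫ p, H (ContinuousLinearMap.rotation θ p) ∂(gauss n).prod (gauss n) =
      ∫ p, H p ∂(gauss n).prod (gauss n) := by
    have := (measurePreserving_rotation n θ).map_eq
    conv_rhs => rw [← this]
    rw [integral_map (by fun_prop) hHm.aestronglyMeasurable]
  simp_rw [hH]
  rw [hrot, integral_prod _ hHint, integral_prod _ hGint, ← integral_const_mul]
  refine integral_congr_ae ?_
  filter_upwards [hae] with x hx
  rw [← integral_const_mul]
  have hlip : LipschitzWith (C * ‖Real.sin θ‖₊) fun y => f (Real.cos θ • x - Real.sin θ • y) := by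
    refine hf.comp (LipschitzWith.of_dist_le_mul fun y z => ?_)
    rw [dist_eq_norm, dist_eq_norm, sub_sub_sub_cancel_left, ← smul_sub, norm_smul, norm_sub_rev,
      coe_nnnorm]
  rw [← integral_gauss_mul_inner hlip (v := gradient f x)
    (D := fun y => -Real.sin θ * ⟪gradient f x, gradient f (Real.cos θ • x - Real.sin θ • y)⟫)]
  · refine integral_congr_ae (ae_of_all _ fun y => ?_)
    simp only [H]
    rw [real_inner_comm]
  · exact ((hGm.comp measurable_prodMk_left).const_mul _).aestronglyMeasurable
  · filter_upwards [hx] with y hy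
    have h1 : HasDerivAt (fun t : ℝ => Real.cos θ • x - Real.sin θ • (y + t • gradient f x))
        (-Real.sin θ • gradient f x) 0 := by
      have h0 : HasDerivAt (fun t : ℝ => y + t • gradient f x) (gradient f x) 0 := by
        simpa using ((hasDerivAt_id (0 : ℝ)).smul_const (gradient f x)).const_add y
      have := (h0.const_smul (Real.sin θ)).const_sub (Real.cos θ • x)
      simpa using this
    have h2 := hy.hasGradientAt.hasFDerivAt
    have h3 : HasFDerivAt f (InnerProductSpace.toDual ℝ (E n)
        (gradient f (Real.cos θ • x - Real.sin θ • y)))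
        (Real.cos θ • x - Real.sin θ • (y + (0 : ℝ) • gradient f x)) := by simpa using h2
    refine (h3.comp_hasDerivAt (0 : ℝ) h1).congr_deriv ?_
    rw [InnerProductSpace.toDual_apply_apply, real_inner_smul_right, real_inner_comm]

/-- Both gradients are evaluated at standard Gaussian vectors, so `2⟪u, v⟫ ≤ |u|² + |v|²` suffices.
-/
theorem integral_inner_gradient_le {C : NNReal} {f : E n → ℝ} (hf : LipschitzWith C f) (θ : ℝ) :
    ∫ p : E n × E n, ⟪gradient f p.1,
        gradient f (Real.cos θ • p.1 - Real.sin θ • p.2)⟫ ∂(gauss n).prod (gauss n) ≤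
      ∫ x, ‖gradient f x‖ ^ 2 ∂gauss n := by
  have hmp := measurePreserving_rotation_fst n (-θ)
  simp only [Real.cos_neg, Real.sin_neg, neg_smul, ← sub_eq_add_neg] at hmp
  have hI := integrable_norm_gradient_sq_of_lipschitzWith hf
  have h1 : Integrable (fun p : E n × E n => ‖gradient f p.1‖ ^ 2) ((gauss n).prod (gauss n)) :=
    measurePreserving_fst.integrable_comp_of_integrable hI
  have h2 : Integrable (fun p : E n × E n =>
      ‖gradient f (Real.cos θ • p.1 - Real.sin θ • p.2)‖ ^ 2) ((gauss n).prod (gauss n)) :=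
    hmp.integrable_comp_of_integrable hI
  have e1 : ∫ p : E n × E n, ‖gradient f p.1‖ ^ 2 ∂(gauss n).prod (gauss n) =
      ∫ x, ‖gradient f x‖ ^ 2 ∂gauss n := by
    rw [integral_fun_fst (μ := gauss n) (ν := gauss n) (fun x => ‖gradient f x‖ ^ 2)]
    simp
  have e2 : ∫ p : E n × E n, ‖gradient f (Real.cos θ • p.1 - Real.sin θ • p.2)‖ ^ 2
      ∂(gauss n).prod (gauss n) = ∫ x, ‖gradient f x‖ ^ 2 ∂gauss n := by
    conv_rhs => rw [← hmp.map_eq]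
    rw [integral_map hmp.aemeasurable
      ((measurable_gradient f).norm.pow_const 2).aestronglyMeasurable]
  calc _ ≤ ∫ p : E n × E n, (‖gradient f p.1‖ ^ 2 +
        ‖gradient f (Real.cos θ • p.1 - Real.sin θ • p.2)‖ ^ 2) / 2
          ∂(gauss n).prod (gauss n) := by
        refine integral_mono (integrable_inner_gradient hf θ) ((h1.add h2).div_const 2) fun p => ?_
        have h3 := real_inner_le_norm (gradient f p.1)
          (gradient f (Real.cos θ • p.1 - Real.sin θ • p.2))
        have h4 := two_mul_le_add_sq ‖gradient f p.1‖
          ‖gradient f (Real.cos θ • p.1 - Real.sin θ • p.2)‖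
        simp only
        linarith
    _ = _ := by
        rw [integral_div, integral_add h1 h2, e1, e2]
        ring

/-- **Gaussian Poincaré inequality** for Lipschitz functions. -/
theorem gaussian_poincare {C : NNReal} {f : E n → ℝ} (hf : LipschitzWith C f) :
    (∫ x, f x ^ 2 ∂gauss n) - ∫ x, ‖gradient f x‖ ^ 2 ∂gauss n ≤ (∫ x, f x ∂gauss n) ^ 2 := by
  set D := ∫ x, ‖gradient f x‖ ^ 2 ∂gauss n
  have hder : ∀ θ, HasDerivAt (fun θ => interpolation f θ - D * Real.cos θ)
      (-Real.sin θ * (∫ p : E n × E n, ⟪gradient f p.1,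
        gradient f (Real.cos θ • p.1 - Real.sin θ • p.2)⟫ ∂(gauss n).prod (gauss n)) -
        D * -Real.sin θ) θ := fun θ => by
    have h1 := (hasDerivAt_interpolation hf θ).2
    rw [interpolation_deriv_eq hf] at h1
    exact h1.sub ((Real.hasDerivAt_cos θ).const_mul D)
  -- At `θ = 0` the two copies coincide and the value is `E f² - D`; at `θ = π/2` they are
  -- independent and the value is `(E f)²`.
  have hmono : MonotoneOn (fun θ => interpolation f θ - D * Real.cos θ)
      (Set.Icc 0 (Real.pi / 2)) := by
    refine monotoneOn_of_deriv_nonneg (convex_Icc _ _)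
      (fun θ _ => (hder θ).continuousAt.continuousWithinAt)
      (fun θ _ => (hder θ).differentiableAt.differentiableWithinAt) fun θ hθ => ?_
    rw [interior_Icc] at hθ
    rw [(hder θ).deriv]
    have hs : 0 ≤ Real.sin θ :=
      Real.sin_nonneg_of_nonneg_of_le_pi hθ.1.le (by linarith [hθ.2, Real.pi_pos])
    have := integral_inner_gradient_le hf θ
    nlinarith
  have h := hmono (Set.left_mem_Icc.2 (by positivity)) (Set.right_mem_Icc.2 (by positivity))
    (by positivity)
  have e0 : interpolation f 0 = ∫ x, f x ^ 2 ∂gauss n := by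
    simp only [interpolation, Real.cos_zero, Real.sin_zero, one_smul, zero_smul, add_zero]
    rw [integral_fun_fst (μ := gauss n) (ν := gauss n) (fun x => f x * f x)]
    simp [pow_two]
  have e1 : interpolation f (Real.pi / 2) = (∫ x, f x ∂gauss n) ^ 2 := by
    simp only [interpolation, Real.cos_pi_div_two, Real.sin_pi_div_two, one_smul, zero_smul,
      zero_add]
    rw [integral_prod_mul, pow_two]
  simp only [e0, e1, Real.cos_zero, Real.cos_pi_div_two] at h
  linarith

/-! ### The area form and its hyperbolic signature -/

theorem memLp_supportFun (K : ConvexBody (E n)) : MemLp (supportFun K) 2 (gauss n) := by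
  obtain ⟨C, hC⟩ := exists_lipschitzWith_supportFun K
  exact memLp_gauss_of_lipschitzWith hC

/-- The Gaussian expression of the mixed area, up to the factor `π`. -/
def gaussMixedArea (A B : ConvexBody (E n)) : ℝ :=
  (∫ x, supportFun A x * supportFun B x ∂gauss n) -
    ∫ x, ⟪gradient (supportFun A) x, gradient (supportFun B) x⟫ ∂gauss n

theorem integral_sq_sub_integral_gradient_combination (A B : ConvexBody (E n)) (s t : ℝ) :
    (∫ x, (s * supportFun A x + t * supportFun B x) ^ 2 ∂gauss n) -
      ∫ x, ‖gradient (fun x => s * supportFun A x + t * supportFun B x) x‖ ^ 2 ∂gauss n =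
    s ^ 2 * gaussMixedArea A A + 2 * s * t * gaussMixedArea A B +
      t ^ 2 * gaussMixedArea B B := by
  obtain ⟨C, hC⟩ := exists_lipschitzWith_supportFun A
  obtain ⟨C', hC'⟩ := exists_lipschitzWith_supportFun B
  have hm : ∀ K L : ConvexBody (E n), Integrable (fun x => supportFun K x * supportFun L x)
    (gauss n) := fun K L => (memLp_supportFun K).integrable_mul (memLp_supportFun L)
  have hg : ∀ K L : ConvexBody (E n), Integrable
      (fun x => ⟪gradient (supportFun K) x, gradient (supportFun L) x⟫) (gauss n) := by
    intro K L
    obtain ⟨R, hR0, hR⟩ := exists_norm_le K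
    obtain ⟨R', hR0', hR'⟩ := exists_norm_le L
    refine (integrable_const (R * R')).mono'
      ((measurable_gradient _).inner (measurable_gradient _)).aestronglyMeasurable
      (ae_of_all _ fun x => (norm_inner_le_norm _ _).trans ?_)
    have h1 := norm_gradient_supportFun_le hR0 hR x
    have h2 := norm_gradient_supportFun_le hR0' hR' x
    gcongr
  have e1 : ∫ x, (s * supportFun A x + t * supportFun B x) ^ 2 ∂gauss n =
      s ^ 2 * (∫ x, supportFun A x * supportFun A x ∂gauss n) +
      2 * s * t * (∫ x, supportFun A x * supportFun B x ∂gauss n) +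
      t ^ 2 * ∫ x, supportFun B x * supportFun B x ∂gauss n := by
    rw [← integral_const_mul, ← integral_const_mul, ← integral_const_mul, ← integral_add
      ((hm A A).const_mul _) ((hm A B).const_mul _), ← integral_add
      (by exact ((hm A A).const_mul _).add ((hm A B).const_mul _)) ((hm B B).const_mul _)]
    exact integral_congr_ae (ae_of_all _ fun x => by simp only; ring)
  have e2 : ∫ x, ‖gradient (fun x => s * supportFun A x + t * supportFun B x) x‖ ^ 2 ∂gauss n =
      s ^ 2 * (∫ x, ⟪gradient (supportFun A) x, gradient (supportFun A) x⟫ ∂gauss n) +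
      2 * s * t * (∫ x, ⟪gradient (supportFun A) x, gradient (supportFun B) x⟫ ∂gauss n) +
      t ^ 2 * ∫ x, ⟪gradient (supportFun B) x, gradient (supportFun B) x⟫ ∂gauss n := by
    rw [← integral_const_mul, ← integral_const_mul, ← integral_const_mul, ← integral_add
      ((hg A A).const_mul _) ((hg A B).const_mul _), ← integral_add
      (by exact ((hg A A).const_mul _).add ((hg A B).const_mul _)) ((hg B B).const_mul _)]
    refine integral_congr_ae ?_
    filter_upwards [ae_differentiableAt_gauss hC, ae_differentiableAt_gauss hC'] with x hA hB
    have h : gradient (fun x => s * supportFun A x + t * supportFun B x) x =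
        s • gradient (supportFun A) x + t • gradient (supportFun B) x := by
      refine HasGradientAt.gradient ?_
      rw [hasGradientAt_iff_hasFDerivAt, map_add, map_smul, map_smul]
      exact (hA.hasGradientAt.hasFDerivAt.const_mul s).add (hB.hasGradientAt.hasFDerivAt.const_mul t)
    rw [h, ← real_inner_self_eq_norm_sq]
    simp only [inner_add_left, inner_add_right, real_inner_smul_left, real_inner_smul_right]
    rw [real_inner_comm (gradient (supportFun A) x) (gradient (supportFun B) x)]
    ring
  rw [e1, e2]
  simp only [gaussMixedArea]
  ring

theorem area_eq_gaussMixedArea (K : ConvexBody (E n)) :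
    area K = Real.pi * gaussMixedArea K K := by
  rw [area, (intrinsicVolume_low K).2.2, gaussMixedArea]
  simp only [real_inner_self_eq_norm_sq, pow_two]

theorem mixedArea_eq_gaussMixedArea (A B : ConvexBody (E n)) :
    mixedArea A B = Real.pi * gaussMixedArea A B := by
  have h := integral_sq_sub_integral_gradient_combination A B 1 1
  simp only [one_mul, ← supportFun_add] at h
  have h2 : area (A + B) = _ := (intrinsicVolume_low (A + B)).2.2
  rw [h] at h2
  rw [mixedArea, h2, area_eq_gaussMixedArea A, area_eq_gaussMixedArea B]
  ring

/-- Poincaré for `s h_A + t h_B`. Coefficients of any sign are allowed, although the combination is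
then no longer a support function; this freedom is what the discriminant argument needs. -/
theorem area_form_le (A B : ConvexBody (E n)) (s t : ℝ) :
    s ^ 2 * area A + 2 * s * t * mixedArea A B + t ^ 2 * area B ≤
      (s * intrinsicVolume 1 A + t * intrinsicVolume 1 B) ^ 2 / 2 := by
  obtain ⟨C, hC⟩ := exists_lipschitzWith_supportFun A
  obtain ⟨C', hC'⟩ := exists_lipschitzWith_supportFun B
  have hlip : LipschitzWith (‖s‖₊ * C + ‖t‖₊ * C')
      fun x => s * supportFun A x + t * supportFun B x :=
    ((lipschitzWith_smul s).comp hC).add ((lipschitzWith_smul t).comp hC')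
  have h := gaussian_poincare hlip
  rw [integral_sq_sub_integral_gradient_combination, integral_add
    ((integrable_supportFun A).const_mul s) ((integrable_supportFun B).const_mul t),
    integral_const_mul, integral_const_mul] at h
  rw [area_eq_gaussMixedArea A, area_eq_gaussMixedArea B, mixedArea_eq_gaussMixedArea,
    (intrinsicVolume_low A).2.1, (intrinsicVolume_low B).2.1]
  have h2 := mul_le_mul_of_nonneg_left h Real.pi_pos.le
  have h3 : √(2 * Real.pi) ^ 2 = 2 * Real.pi := Real.sq_sqrt (by positivity)
  calc _ = Real.pi * (s ^ 2 * gaussMixedArea A A + 2 * s * t * gaussMixedArea A B +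
      t ^ 2 * gaussMixedArea B B) := by ring
    _ ≤ _ := h2
    _ = 2 * Real.pi * (s * (∫ x, supportFun A x ∂gauss n) +
      t * ∫ x, supportFun B x ∂gauss n) ^ 2 / 2 := by ring
    _ = _ := by linear_combination -(s * (∫ x, supportFun A x ∂gauss n) +
      t * ∫ x, supportFun B x ∂gauss n) ^ 2 / 2 * h3

theorem two_mul_area_le (K : ConvexBody (E n)) : 2 * area K ≤ intrinsicVolume 1 K ^ 2 := by
  have := area_form_le K K 1 0
  norm_num at this
  linarith

/-- The mixed area is a Lorentzian form. -/
theorem sq_sub_mixedArea_le (A B : ConvexBody (E n)) :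
    (intrinsicVolume 1 A * intrinsicVolume 1 B - 2 * mixedArea A B) ^ 2 ≤
      (intrinsicVolume 1 A ^ 2 - 2 * area A) * (intrinsicVolume 1 B ^ 2 - 2 * area B) := by
  -- Cauchy–Schwarz for the semidefinite form `V_1² - 2 V_2`, as the discriminant of `s ↦` its value
  -- at `s A + B`.
  have h := discrim_le_zero (a := intrinsicVolume 1 A ^ 2 - 2 * area A)
    (b := 2 * (intrinsicVolume 1 A * intrinsicVolume 1 B - 2 * mixedArea A B))
    (c := intrinsicVolume 1 B ^ 2 - 2 * area B) fun s => by
      have := area_form_le A B s 1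
      nlinarith
  rw [discrim] at h
  linarith

/-- The support function dominates a linear form, whose Gaussian mean is zero. -/
theorem intrinsicVolume_one_nonneg (K : ConvexBody (E n)) : 0 ≤ intrinsicVolume 1 K := by
  rw [(intrinsicVolume_low K).2.1]
  refine mul_nonneg (Real.sqrt_nonneg _) ?_
  obtain ⟨k, hk⟩ := K.nonempty
  have h0 : ∫ x, ⟪x, k⟫ ∂gauss n = 0 := by
    have := integral_strongDual_stdGaussian (E := E n) (InnerProductSpace.toDual ℝ (E n) k)
    simpa [real_inner_comm] using this
  rw [← h0]
  refine integral_mono ?_ (integrable_supportFun K) fun x => le_supportFun hk x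
  exact (IsGaussian.integrable_id (μ := gauss n)).inner_const k

/-! ### Invariance -/

theorem intrinsicVolume_of_homothety {K L : ConvexBody (E n)} {c : ℝ} (hc : 0 < c) {t : E n}
    (h : (L : Set (E n)) = (fun x => c • x + t) '' K) (i : ℕ) :
    intrinsicVolume i L = c ^ i * intrinsicVolume i K := by
  have hS := isSteinerCoeff_smul (isSteinerCoeff_intrinsicVolume K) hc
  refine IsSteinerCoeff.intrinsicVolume_eq (V := fun i => c ^ i * intrinsicVolume i K)
    ⟨hS.1, fun ε hε => ?_⟩ i
  rw [← hS.2 ε hε]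
  have hset : ((L + ε • unitBall n : ConvexBody (E n)) : Set (E n)) =
      (fun x => x + t) '' ((c • K + ε • unitBall n : ConvexBody (E n)) : Set (E n)) := by
    have hL : (L : Set (E n)) = c • (K : Set (E n)) + {t} := by
      rw [h, Set.add_singleton, ← Set.image_smul, Set.image_image]
    rw [ConvexBody.coe_add, ConvexBody.coe_add, hL, ← Set.add_singleton, ConvexBody.coe_smul c K]
    exact add_right_comm _ _ _
  rw [hset, Set.image_add_right, Measure.real, measure_preimage_add_right]
  rfl

theorem supportFun_mapBody {m n : ℕ} (f : E m →ₗᵢ[ℝ] E n) (K : ConvexBody (E m)) (x : E n) :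
    supportFun (mapBody f K) x = supportFun K (f.toContinuousLinearMap.adjoint x) := by
  have h : ∀ k : E m, ⟪f.toContinuousLinearMap.adjoint x, k⟫ = ⟪x, f k⟫ := fun k =>
    ContinuousLinearMap.adjoint_inner_left _ _ _
  simp only [supportFun, h]
  congr 1
  exact Set.image_image _ _ _

theorem integral_gauss_comp_adjoint {m n : ℕ} (f : E m →ₗᵢ[ℝ] E n) {g : E m → ℝ}
    (hg : Measurable g) :
    ∫ x, g (f.toContinuousLinearMap.adjoint x) ∂gauss n = ∫ y, g y ∂gauss m := by
  rw [← gauss_map_adjoint f, integral_map (by fun_prop) hg.aestronglyMeasurable]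

theorem measurable_supportFun (K : ConvexBody (E n)) : Measurable (supportFun K) := by
  obtain ⟨C, hC⟩ := exists_lipschitzWith_supportFun K
  exact hC.continuous.measurable

theorem intrinsicVolume_one_mapBody {m n : ℕ} (f : E m →ₗᵢ[ℝ] E n) (K : ConvexBody (E m)) :
    intrinsicVolume 1 (mapBody f K) = intrinsicVolume 1 K := by
  rw [(intrinsicVolume_low K).2.1, (intrinsicVolume_low (mapBody f K)).2.1]
  simp_rw [supportFun_mapBody]
  rw [integral_gauss_comp_adjoint f (measurable_supportFun K)]

/-- The support function of the image is `h_K` composed with the adjoint of `f`, which carries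
Gaussian to Gaussian; almost everywhere the new gradient is the `f`-image of the old one. One
argument covers rotations and inclusions. -/
theorem area_mapBody {m n : ℕ} (f : E m →ₗᵢ[ℝ] E n) (K : ConvexBody (E m)) :
    area (mapBody f K) = area K := by
  obtain ⟨C, hC⟩ := exists_lipschitzWith_supportFun K
  have hmp : MeasurePreserving (f.toContinuousLinearMap.adjoint) (gauss n) (gauss m) :=
    ⟨by fun_prop, gauss_map_adjoint f⟩
  have hgrad : ∀ᵐ x ∂gauss n, ‖gradient (supportFun (mapBody f K)) x‖ ^ 2 =
      ‖gradient (supportFun K) (f.toContinuousLinearMap.adjoint x)‖ ^ 2 := by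
    filter_upwards [hmp.quasiMeasurePreserving.ae (ae_differentiableAt_gauss hC)] with x hx
    obtain ⟨k, hk, h⟩ := exists_inner_eq_supportFun K (f.toContinuousLinearMap.adjoint x)
    have hd : DifferentiableAt ℝ (supportFun (mapBody f K)) x := by
      have e : supportFun (mapBody f K) =
        supportFun K ∘ f.toContinuousLinearMap.adjoint := funext (supportFun_mapBody f K)
      rw [e]
      exact hx.comp x (f.toContinuousLinearMap.adjoint.differentiableAt)
    have hk' : f k ∈ mapBody f K := Set.mem_image_of_mem f hk
    have h' : ⟪x, f k⟫ = supportFun (mapBody f K) x := by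
      rw [supportFun_mapBody, ← h]
      exact (ContinuousLinearMap.adjoint_inner_left f.toContinuousLinearMap k x).symm
    rw [gradient_supportFun hx hk h, gradient_supportFun hd hk' h', f.norm_map]
  rw [area, area, (intrinsicVolume_low K).2.2, (intrinsicVolume_low (mapBody f K)).2.2,
    integral_congr_ae hgrad]
  simp_rw [supportFun_mapBody]
  rw [integral_gauss_comp_adjoint f ((measurable_supportFun K).pow_const 2),
    integral_gauss_comp_adjoint f ((measurable_gradient (supportFun K)).norm.pow_const 2)]

/-! ### Balls -/

theorem integral_pow_add_two_mul_exp_neg_sq (m : ℕ) :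
    ∫ r in Set.Ioi (0 : ℝ), r ^ (m + 2 + 1) * Real.exp (-r ^ 2 / 2) =
      (m + 2) * ∫ r in Set.Ioi (0 : ℝ), r ^ (m + 1) * Real.exp (-r ^ 2 / 2) := by
  have h : ∀ m : ℕ, ∫ r in Set.Ioi (0 : ℝ), r ^ (m + 1) * Real.exp (-r ^ 2 / 2) =
      (1 / 2 : ℝ) ^ (-((m : ℝ) / 2 + 1)) * (1 / 2) * Real.Gamma ((m : ℝ) / 2 + 1) := by
    intro m
    have h1 := integral_rpow_mul_exp_neg_mul_rpow (p := 2) (q := (m : ℝ) + 1) (b := 1 / 2)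
      two_pos (by have : (0 : ℝ) ≤ m := m.cast_nonneg
                  linarith) (by norm_num)
    have e1 : -((m : ℝ) + 1 + 1) / 2 = -((m : ℝ) / 2 + 1) := by ring
    have e2 : ((m : ℝ) + 1 + 1) / 2 = (m : ℝ) / 2 + 1 := by ring
    rw [e1, e2] at h1
    rw [← h1]
    refine setIntegral_congr_fun measurableSet_Ioi fun r _ => ?_
    have e3 : r ^ ((m : ℝ) + 1) = r ^ (m + 1) := by exact_mod_cast Real.rpow_natCast r (m + 1)
    simp only [e3, Real.rpow_two]
    congr 2
    ring
  rw [h, h]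
  push_cast
  have e : ((m : ℝ) + 2) / 2 + 1 = ((m : ℝ) / 2 + 1) + 1 := by ring
  rw [e, Real.Gamma_add_one (by positivity), neg_add ((m : ℝ) / 2 + 1) 1,
    Real.rpow_add (by norm_num), Real.rpow_neg_one]
  ring

/-- Comparison of `kappa_mul_integral` in dimensions `m` and `m + 2`, whose radial integrals differ
by the factor `m + 2`. -/
theorem kappa_add_two (m : ℕ) : ((m : ℝ) + 2) * kappa (m + 2) = 2 * Real.pi * kappa m := by
  have h1 := kappa_mul_integral m
  have h2 := kappa_mul_integral (m + 2)
  rw [integral_pow_add_two_mul_exp_neg_sq, pow_add, Real.sq_sqrt (by positivity), ← h1] at h2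
  have h3 : (∫ r in Set.Ioi (0 : ℝ), r ^ (m + 1) * Real.exp (-r ^ 2 / 2)) ≠ 0 := by
    intro h
    rw [h, mul_zero] at h1
    have : 0 < √(2 * Real.pi) ^ m := by positivity
    linarith
  refine mul_right_cancel₀ h3 ?_
  linear_combination h2

theorem area_unitBall (m : ℕ) : area (unitBall (m + 2)) = (m + 1) * Real.pi := by
  rw [area, (isSteinerCoeff_unitBall (m + 2)).intrinsicVolume_eq, Nat.add_sub_cancel]
  have h := kappa_add_two m
  have h0 := (kappa_pos m).ne'
  have hc : (((m + 2).choose 2 : ℕ) : ℝ) = (m + 2) * (m + 1) / 2 := by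
    rw [Nat.cast_choose_two]; push_cast; ring
  rw [hc, div_eq_iff h0]
  linear_combination (m + 1) / 2 * h

theorem intrinsicVolume_one_unitBall (m : ℕ) :
    intrinsicVolume 1 (unitBall (m + 1)) = (m + 1) * kappa (m + 1) / kappa m := by
  rw [(isSteinerCoeff_unitBall (m + 1)).intrinsicVolume_eq]
  simp

/-- Jensen, in reverse to the Poincaré inequality: `(E h)² ≤ E h² = V_2/π + E |∇h|²`, with `|∇h| ≤
1` for the unit ball. It forces the isoperimetric ratio of balls to tend to `1`. -/
theorem intrinsicVolume_one_unitBall_sq_le (m : ℕ) :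
    intrinsicVolume 1 (unitBall (m + 2)) ^ 2 ≤ 2 * Real.pi * (m + 2) := by
  have h1 := (intrinsicVolume_low (unitBall (m + 2))).2.1
  have h2 : area (unitBall (m + 2)) = _ := (intrinsicVolume_low (unitBall (m + 2))).2.2
  have hvar := variance_nonneg (supportFun (unitBall (m + 2))) (gauss (m + 2))
  rw [variance_eq_sub (memLp_supportFun _)] at hvar
  have hgr : ∫ x, ‖gradient (supportFun (unitBall (m + 2))) x‖ ^ 2 ∂gauss (m + 2) ≤ 1 := by
    have : ∀ x, ‖gradient (supportFun (unitBall (m + 2))) x‖ ^ 2 ≤ 1 := fun x => by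
      have := norm_gradient_supportFun_le zero_le_one
        (K := unitBall (m + 2)) (fun k hk => by simpa using! mem_closedBall_zero_iff.1 hk) x
      exact pow_le_one₀ (norm_nonneg _) this
    simpa using integral_mono (integrable_norm_gradient_sq (unitBall (m + 2)))
      (integrable_const (1 : ℝ)) this
  rw [area_unitBall, mul_comm] at h2
  have h3 := mul_left_cancel₀ Real.pi_pos.ne' h2
  rw [h1, mul_pow, Real.sq_sqrt (by positivity)]
  refine mul_le_mul_of_nonneg_left ?_ (by positivity)
  simp only [Pi.pow_apply] at hvar
  linarith

/-! ### Mixed area with the ball, and the strict inequality -/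

theorem isSteinerCoeff_add_unitBall {K : ConvexBody (E n)} {V : ℕ → ℝ} (hV : IsSteinerCoeff K V) :
    IsSteinerCoeff (K + unitBall n) fun i => if i ≤ n then
      (∑ j ∈ Finset.range (n + 1), (n - j).choose (n - i) * (kappa (n - j) * V j)) / kappa (n - i)
      else 0 := by
  refine ⟨fun i hi => if_neg (by omega), fun ε hε => ?_⟩
  have hB : (K + unitBall n + ε • unitBall n : ConvexBody (E n)) = K + (1 + ε) • unitBall n := by
    refine ConvexBody.ext ?_
    rw [ConvexBody.coe_add, ConvexBody.coe_add, ConvexBody.coe_add, ConvexBody.coe_smul,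
      ConvexBody.coe_smul, (unitBall n).convex.add_smul zero_le_one hε.le, one_smul, add_assoc]
  rw [hB, hV.2 _ (by positivity)]
  have hbin : ∀ j ∈ Finset.range (n + 1), ∑ i ∈ Finset.range (n + 1),
      ε ^ (n - i) * ((n - j).choose (n - i) : ℝ) = (1 + ε) ^ (n - j) := by
    intro j _
    have h1 := Finset.sum_range_reflect (fun i => ε ^ i * ((n - j).choose i : ℝ)) (n + 1)
    have h2 : ∀ i, n + 1 - 1 - i = n - i := fun i => by omega
    simp only [h2] at h1
    rw [h1, add_comm 1 ε, add_pow]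
    simp only [one_pow, mul_one]
    refine (Finset.sum_subset (Finset.range_mono (by omega)) fun i _ hi => ?_).symm
    rw [Nat.choose_eq_zero_of_lt (by simpa using hi)]
    simp
  calc _ = ∑ j ∈ Finset.range (n + 1), ∑ i ∈ Finset.range (n + 1),
        ε ^ (n - i) * ((n - j).choose (n - i) * (kappa (n - j) * V j)) := by
        refine Finset.sum_congr rfl fun j hj => ?_
        rw [← hbin j hj, Finset.sum_mul, Finset.sum_mul]
        exact Finset.sum_congr rfl fun i _ => by ring
    _ = _ := by
        rw [Finset.sum_comm]
        refine Finset.sum_congr rfl fun i hi => ?_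
        have hi' : i ≤ n := by have := Finset.mem_range.1 hi; omega
        have := (kappa_pos (n - i)).ne'
        simp only [if_pos hi']
        rw [← Finset.mul_sum]
        field_simp

/-- The intrinsic volumes of `K + B` come from expanding `(1 + ε)^(n-j)` in the Steiner formula of
`K`. For `V_2` only `j ≤ 2` survive, and polarization leaves the term in `V_1(K)`. The factor is
`V_1` of the ball one dimension lower. -/
theorem mixedArea_unitBall {m : ℕ} (K : ConvexBody (E (m + 2))) :
    2 * mixedArea K (unitBall (m + 2)) = (m + 1) * kappa (m + 1) / kappa m * intrinsicVolume 1 K := by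
  have h1 := (isSteinerCoeff_add_unitBall (isSteinerCoeff_intrinsicVolume K)).intrinsicVolume_eq 2
  rw [if_pos (by omega)] at h1
  have h2 : ∑ j ∈ Finset.range (m + 2 + 1), ((m + 2 - j).choose (m + 2 - 2) : ℝ) *
      (kappa (m + 2 - j) * intrinsicVolume j K) =
      (m + 2) * (m + 1) / 2 * kappa (m + 2) + (m + 1) * (kappa (m + 1) * intrinsicVolume 1 K) +
        kappa m * intrinsicVolume 2 K := by
    rw [← Finset.sum_subset (Finset.range_mono (show 3 ≤ m + 2 + 1 by omega))]
    · rw [Finset.sum_range_succ, Finset.sum_range_succ, Finset.sum_range_one,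
        (intrinsicVolume_low K).1]
      have e1 : (((m + 2).choose m : ℕ) : ℝ) = (m + 2) * (m + 1) / 2 := by
        rw [← Nat.choose_symm_of_eq_add (show m + 2 = 2 + m by ring), Nat.cast_choose_two]
        push_cast; ring
      have e2 : m + 2 - 1 = m + 1 := by omega
      simp only [Nat.sub_zero, Nat.add_sub_cancel, e2, e1, Nat.choose_succ_self_right,
        Nat.choose_self]
      push_cast
      ring
    · intro j _ hj
      have hj' : 3 ≤ j := by simpa using hj
      by_cases hjm : j ≤ m + 2
      · rw [Nat.choose_eq_zero_of_lt (by omega)]; simp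
      · rw [intrinsicVolume_eq_zero K (by omega)]; simp
  rw [h2] at h1
  have h3 : area (K + unitBall (m + 2)) = _ := h1
  have hk := (kappa_pos m).ne'
  rw [mixedArea, h3, area_unitBall, area, Nat.add_sub_cancel]
  have h4 := kappa_add_two m
  field_simp
  linear_combination (m + 1) * h4

/-- If equality held, Cauchy–Schwarz against the unit ball would give `V_1(B^(m+2)) = V_1(B^(m+1))`,
a relation between `κ_m`, `κ_(m+1)` and `κ_(m+2)`. Together with the weak inequality for a larger
ball it would yield `(m+2)² ≤ (m+1)(m+3)`. -/
theorem two_mul_area_lt {K : ConvexBody (E n)} (hK : 0 < area K) :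
    2 * area K < intrinsicVolume 1 K ^ 2 := by
  obtain ⟨m, rfl⟩ : ∃ m, n = m + 2 := by
    refine Nat.exists_eq_add_of_le' ?_
    by_contra! h
    rw [area, intrinsicVolume_eq_zero K h] at hK
    exact lt_irrefl _ hK
  refine lt_of_le_of_ne (two_mul_area_le K) fun heq => ?_
  have h1 := sq_sub_mixedArea_le K (unitBall (m + 2))
  rw [← heq, sub_self, zero_mul, mixedArea_unitBall, intrinsicVolume_one_unitBall (m + 1)] at h1
  have hV : intrinsicVolume 1 K ≠ 0 := by
    intro h
    rw [h] at heq
    nlinarith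
  have h2 := pow_eq_zero_iff two_ne_zero |>.1 (le_antisymm h1 (sq_nonneg _))
  have p0 := kappa_pos m
  have p1 := kappa_pos (m + 1)
  have h3 : (m + 2) * kappa (m + 2) * kappa m = (m + 1) * kappa (m + 1) ^ 2 := by
    have h4 : intrinsicVolume 1 K * ((((m + 1 : ℕ) : ℝ) + 1) * kappa (m + 1 + 1) / kappa (m + 1) -
        (m + 1) * kappa (m + 1) / kappa m) = 0 := by
      rw [← h2]; ring
    have h5 := (mul_eq_zero.1 h4).resolve_left hV
    rw [sub_eq_zero, div_eq_div_iff p1.ne' p0.ne'] at h5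
    push_cast at h5
    linear_combination h5
  have k0 := kappa_add_two m
  have k1 := kappa_add_two (m + 1)
  have k2 := kappa_add_two (m + 2)
  -- Dimension `m + 4` is chosen so that the recursion by two steps brings its constants back to
  -- `κ_(m+1)` and `κ_(m+2)`, then to `κ_m`.
  have h6 := two_mul_area_le (unitBall (m + 2 + 2))
  rw [area_unitBall, intrinsicVolume_one_unitBall (m + 2 + 1)] at h6
  have p3 := kappa_pos (m + 2 + 1)
  push_cast at h6 k1 k2
  have e4 : ((m : ℝ) + 2 + 1 + 1) * kappa (m + 2 + 1 + 1) = 2 * Real.pi * kappa (m + 2) := by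
    rw [← k2]; ring_nf
  have e5 : ((m : ℝ) + 3) * kappa (m + 2 + 1) = 2 * Real.pi * kappa (m + 1) := by
    rw [← k1]; ring_nf
  rw [e4, div_pow, le_div_iff₀ (by positivity)] at h6
  set a := kappa m
  set b := kappa (m + 1)
  set c := kappa (m + 2)
  set d := kappa (m + 2 + 1)
  have hpi := Real.pi_pos
  have h7 : 2 * Real.pi * b ^ 2 ≤ (m + 3) * c ^ 2 := by
    refine le_of_mul_le_mul_left ?_ (show 0 < 4 * Real.pi ^ 2 by positivity)
    have := mul_le_mul_of_nonneg_left h6 (show (0 : ℝ) ≤ m + 3 by positivity)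
    calc _ = 2 * Real.pi * (2 * Real.pi * b) ^ 2 := by ring
      _ = (m + 3) * (2 * ((m + 2 + 1) * Real.pi) * d ^ 2) := by rw [← e5]; ring
      _ ≤ _ := this
      _ = _ := by ring
  have h8 : (m + 2) ^ 2 * b ^ 2 ≤ (m + 3) * (2 * Real.pi * a ^ 2) := by
    refine le_of_mul_le_mul_left ?_ (show 0 < 2 * Real.pi by positivity)
    have := mul_le_mul_of_nonneg_left h7 (show (0 : ℝ) ≤ (m + 2) ^ 2 by positivity)
    calc _ = (m + 2) ^ 2 * (2 * Real.pi * b ^ 2) := by ring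
      _ ≤ _ := this
      _ = (m + 3) * ((m + 2) * c) ^ 2 := by ring
      _ = _ := by rw [k0]; ring
  have h9 : 2 * Real.pi * a ^ 2 = (m + 1) * b ^ 2 := by
    rw [← h3]; linear_combination -a * k0
  rw [h9] at h8
  have : 0 < b ^ 2 := by positivity
  nlinarith

/-! ### The isoperimetric ratio as an invariant of shapes -/

/-- The isoperimetric ratio `V_1² / (2 V_2)`. -/
def isoRatio (K : ConvexBody (E n)) : ℝ := intrinsicVolume 1 K ^ 2 / (2 * area K)

theorem one_lt_isoRatio {K : ConvexBody (E n)} (hK : 0 < area K) : 1 < isoRatio K := by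
  rw [isoRatio, lt_div_iff₀ (by positivity), one_mul]
  exact two_mul_area_lt hK

theorem area_pos_of_homothety {K L : ConvexBody (E n)} (h : homothetySetoid n K L)
    (hK : 0 < area K) : 0 < area L := by
  obtain ⟨c, hc, t, h⟩ := h
  rw [area, intrinsicVolume_of_homothety hc h]
  rw [area] at hK
  positivity

theorem isoRatio_of_homothety {K L : ConvexBody (E n)} (h : homothetySetoid n K L) :
    isoRatio K = isoRatio L := by
  obtain ⟨c, hc, t, h⟩ := h
  rw [isoRatio, isoRatio, area, area, intrinsicVolume_of_homothety hc h,
    intrinsicVolume_of_homothety hc h, pow_one, mul_pow, mul_left_comm 2 (c ^ 2),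
    mul_div_mul_left _ _ (by positivity)]

theorem isoRatio_mapBody {m n : ℕ} (f : E m →ₗᵢ[ℝ] E n) (K : ConvexBody (E m)) :
    isoRatio (mapBody f K) = isoRatio K := by
  rw [isoRatio, isoRatio, area_mapBody, intrinsicVolume_one_mapBody]

theorem isoRatio_unitBall_le (m : ℕ) : isoRatio (unitBall (m + 2)) ≤ 1 + 1 / ((m : ℝ) + 1) := by
  have h := intrinsicVolume_one_unitBall_sq_le m
  have hpi := Real.pi_pos
  rw [isoRatio, area_unitBall, div_le_iff₀ (by positivity)]
  refine h.trans_eq ?_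
  field_simp
  ring

/-- The isoperimetric ratio of an oriented shape. -/
def OShape.isoRatio : OShape n → ℝ :=
  Quotient.lift Shapes.isoRatio fun _ _ h => isoRatio_of_homothety h

theorem OShape.isoRatio_map {m n : ℕ} (f : E m →ₗᵢ[ℝ] E n) (x : OShape m) :
    OShape.isoRatio (OShape.map f x) = OShape.isoRatio x := by
  induction x using Quotient.inductionOn with
  | h K => exact isoRatio_mapBody f K

theorem area_pos_of_mk_mem {K : ConvexBody (E n)} (h : OShape.mk K ∈ OShapeStar n) :
    0 < area K := by
  obtain ⟨L, hL, h⟩ := h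
  exact area_pos_of_homothety (Quotient.exact h) hL

theorem OShape.map_mem_star {m n : ℕ} (f : E m →ₗᵢ[ℝ] E n) {x : OShape m}
    (hx : x ∈ OShapeStar m) : OShape.map f x ∈ OShapeStar n := by
  obtain ⟨K, hK, rfl⟩ := hx
  exact ⟨mapBody f K, by rwa [area_mapBody], rfl⟩

/-- The isoperimetric ratio of a shape. -/
def Shape.isoRatio : Shape n → ℝ :=
  Quotient.lift OShape.isoRatio <| by
    rintro x _ ⟨Φ, rfl⟩
    exact (OShape.isoRatio_map _ x).symm

theorem Shape.isoRatio_incl {m n : ℕ} (h : m ≤ n) (x : Shape m) :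
    Shape.isoRatio (Shape.incl h x) = Shape.isoRatio x := by
  induction x using Quotient.inductionOn with
  | h a => exact OShape.isoRatio_map _ a

theorem mem_star_of_mk_mem {a : OShape n} (h : Shape.mk a ∈ ShapeStar n) : a ∈ OShapeStar n := by
  obtain ⟨b, hb, h⟩ := h
  obtain ⟨Φ, rfl⟩ := Quotient.exact h
  exact OShape.map_mem_star _ hb

theorem Shape.incl_mem_star {m n : ℕ} (h : m ≤ n) {x : Shape m} (hx : x ∈ ShapeStar m) :
    Shape.incl h x ∈ ShapeStar n := by
  obtain ⟨a, ha, rfl⟩ := hx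
  exact ⟨OShape.map (Shapes.incl h) a, OShape.map_mem_star _ ha, rfl⟩

/-- The isoperimetric ratio on the inductive limit of the spaces of oriented shapes. -/
def OShapeInf.isoRatio : OShapeInf → ℝ :=
  Quotient.lift (fun x => OShape.isoRatio x.2.1) <| by
    rintro x y ⟨p, hi, hj, h⟩
    rw [← OShape.isoRatio_map (Shapes.incl hi), h, OShape.isoRatio_map]

/-- The isoperimetric ratio on the inductive limit of the spaces of shapes. -/
def ShapeInf.isoRatio : ShapeInf → ℝ :=
  Quotient.lift (fun x => Shape.isoRatio x.2.1) <| by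
    rintro x y ⟨p, hi, hj, h⟩
    rw [← Shape.isoRatio_incl hi, h, Shape.isoRatio_incl]

theorem OShapeInf.one_lt_isoRatio (x : OShapeInf) : 1 < OShapeInf.isoRatio x := by
  induction x using Quotient.inductionOn with
  | h x =>
    obtain ⟨n, x, K, hK, rfl⟩ := x
    exact Shapes.one_lt_isoRatio hK

theorem ShapeInf.one_lt_isoRatio (x : ShapeInf) : 1 < ShapeInf.isoRatio x := by
  induction x using Quotient.inductionOn with
  | h x =>
    obtain ⟨n, x, a, ⟨K, hK, rfl⟩, rfl⟩ := x
    exact Shapes.one_lt_isoRatio hK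

/-! ### Two-sided bounds for the distances -/

/-- The interval of the possible distances between shapes of isoperimetric ratios `α` and `β`. -/
def distInterval (α β : ℝ) : Set ℝ :=
  Set.Icc (Real.arcosh (√(α * β) - √((α - 1) * (β - 1))))
    (Real.arcosh (√(α * β) + √((α - 1) * (β - 1))))

theorem sqrt_sub_one_lt {α β : ℝ} (hα : 1 < α) (hβ : 1 < β) :
    √((α - 1) * (β - 1)) < √(α * β) :=
  Real.sqrt_lt_sqrt (by nlinarith) (by nlinarith)

/-- The Lorentzian inequality divided by `4 V_2(A) V_2(B)`. With `isoRatio = cosh²` the two bounds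
are hyperbolic cosines of the difference and of the sum. -/
theorem abs_mixedArea_div_sub_le {A B : ConvexBody (E n)} (hA : 0 < area A) (hB : 0 < area B) :
    |mixedArea A B / √(area A * area B) - √(isoRatio A * isoRatio B)| ≤
      √((isoRatio A - 1) * (isoRatio B - 1)) := by
  have hs : 0 < √(area A * area B) := by positivity
  have h := sq_sub_mixedArea_le A B
  have e1 : √(isoRatio A * isoRatio B) =
      intrinsicVolume 1 A * intrinsicVolume 1 B / (2 * √(area A * area B)) := by
    have hA' := intrinsicVolume_one_nonneg A
    have hB' := intrinsicVolume_one_nonneg B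
    rw [Real.sqrt_eq_iff_eq_sq]
    · rw [isoRatio, isoRatio, div_pow, mul_pow, mul_pow, Real.sq_sqrt (by positivity)]
      field_simp
    · unfold isoRatio; positivity
    · positivity
  refine Real.abs_le_sqrt ?_
  have e2 : mixedArea A B / √(area A * area B) - √(isoRatio A * isoRatio B) =
      -(intrinsicVolume 1 A * intrinsicVolume 1 B - 2 * mixedArea A B) /
        (2 * √(area A * area B)) := by
    rw [e1]; field_simp; ring
  have e3 : (isoRatio A - 1) * (isoRatio B - 1) =
      (intrinsicVolume 1 A ^ 2 - 2 * area A) * (intrinsicVolume 1 B ^ 2 - 2 * area B) /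
        (4 * (area A * area B)) := by
    rw [isoRatio, isoRatio]; field_simp; ring
  rw [e2, e3, div_pow, neg_sq, mul_pow, Real.sq_sqrt (by positivity)]
  norm_num
  gcongr

theorem areaDist_mem {A B : ConvexBody (E n)} (hA : 0 < area A) (hB : 0 < area B) :
    areaDist A B ∈ distInterval (isoRatio A) (isoRatio B) := by
  have h := abs_le.1 (abs_mixedArea_div_sub_le hA hB)
  have h1 := sqrt_sub_one_lt (one_lt_isoRatio hA) (one_lt_isoRatio hB)
  have h2 := Real.sqrt_nonneg ((isoRatio A - 1) * (isoRatio B - 1))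
  constructor
  · exact (Real.arcosh_le_arcosh (by linarith) (by linarith)).2 (by linarith)
  · exact (Real.arcosh_le_arcosh (by linarith) (by linarith)).2 (by linarith)

/-- Lets the bounds pass through each nested infimum defining the distances, so that independence of
representatives need not be established. -/
theorem csInf_mem_Icc {S : Set ℝ} {a b : ℝ} (hne : S.Nonempty) (hS : ∀ r ∈ S, r ∈ Set.Icc a b) :
    sInf S ∈ Set.Icc a b := by
  obtain ⟨r, hr⟩ := hne
  exact ⟨le_csInf ⟨r, hr⟩ fun s hs => (hS s hs).1,
    (csInf_le ⟨a, fun s hs => (hS s hs).1⟩ hr).trans (hS r hr).2⟩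

theorem OShape.dist_mem {x y : OShape n} (hx : x ∈ OShapeStar n) (hy : y ∈ OShapeStar n) :
    OShape.dist x y ∈ distInterval (OShape.isoRatio x) (OShape.isoRatio y) := by
  refine csInf_mem_Icc ?_ ?_
  · obtain ⟨K, -, rfl⟩ := hx
    obtain ⟨L, -, rfl⟩ := hy
    exact ⟨_, K, L, rfl, rfl, rfl⟩
  · rintro _ ⟨K, L, rfl, rfl, rfl⟩
    exact areaDist_mem (area_pos_of_mk_mem hx) (area_pos_of_mk_mem hy)

theorem Shape.dist_mem {x y : Shape n} (hx : x ∈ ShapeStar n) (hy : y ∈ ShapeStar n) :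
    Shape.dist x y ∈ distInterval (Shape.isoRatio x) (Shape.isoRatio y) := by
  refine csInf_mem_Icc ?_ ?_
  · obtain ⟨a, -, rfl⟩ := hx
    obtain ⟨b, -, rfl⟩ := hy
    exact ⟨_, a, b, rfl, rfl, LinearIsometryEquiv.refl ℝ _, LinearIsometryEquiv.refl ℝ _, rfl⟩
  · rintro _ ⟨a, b, rfl, rfl, Φ, Ψ, rfl⟩
    have h := OShape.dist_mem (OShape.map_mem_star Φ.toLinearIsometry (mem_star_of_mk_mem hx))
      (OShape.map_mem_star Ψ.toLinearIsometry (mem_star_of_mk_mem hy))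
    rw [OShape.isoRatio_map, OShape.isoRatio_map] at h
    exact h

theorem OShapeInf.exists_mk_eq (x : OShapeInf) :
    ∃ m, ∀ n, m ≤ n → ∃ a : OShapeStar n, OShapeInf.mk a = x := by
  induction x using Quotient.inductionOn with
  | h x =>
    refine ⟨x.1, fun n h => ⟨⟨OShape.map (incl h) x.2.1, OShape.map_mem_star _ x.2.2⟩, ?_⟩⟩
    refine Quotient.sound ⟨n, le_rfl, h, ?_⟩
    rw [OShape.map_map, incl_comp]

theorem ShapeInf.exists_mk_eq (x : ShapeInf) :
    ∃ m, ∀ n, m ≤ n → ∃ a : ShapeStar n, ShapeInf.mk a = x := by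
  induction x using Quotient.inductionOn with
  | h x =>
    refine ⟨x.1, fun n h => ⟨⟨Shape.incl h x.2.1, Shape.incl_mem_star h x.2.2⟩, ?_⟩⟩
    exact Quotient.sound ⟨n, le_rfl, h, Shape.incl_incl _ _ _⟩

theorem OShapeInf.dist_mem (x y : OShapeInf) :
    OShapeInf.dist x y ∈ distInterval (OShapeInf.isoRatio x) (OShapeInf.isoRatio y) := by
  refine csInf_mem_Icc ?_ ?_
  · obtain ⟨m, hm⟩ := x.exists_mk_eq
    obtain ⟨m', hm'⟩ := y.exists_mk_eq
    obtain ⟨a, ha⟩ := hm (max m m') (le_max_left _ _)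
    obtain ⟨b, hb⟩ := hm' (max m m') (le_max_right _ _)
    exact ⟨_, _, a, b, ha, hb, rfl⟩
  · rintro _ ⟨n, a, b, rfl, rfl, rfl⟩
    exact OShape.dist_mem a.2 b.2

theorem ShapeInf.dist_mem (x y : ShapeInf) :
    ShapeInf.dist x y ∈ distInterval (ShapeInf.isoRatio x) (ShapeInf.isoRatio y) := by
  refine csInf_mem_Icc ?_ ?_
  · obtain ⟨m, hm⟩ := x.exists_mk_eq
    obtain ⟨m', hm'⟩ := y.exists_mk_eq
    obtain ⟨a, ha⟩ := hm (max m m') (le_max_left _ _)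
    obtain ⟨b, hb⟩ := hm' (max m m') (le_max_right _ _)
    exact ⟨_, _, a, b, ha, hb, rfl⟩
  · rintro _ ⟨n, a, b, rfl, rfl, rfl⟩
    exact Shape.dist_mem a.2 b.2

/-! ### Sequences whose isoperimetric ratio tends to `1` -/

section

variable {X : Type} {d : X → X → ℝ} {ρ : X → ℝ} {u : ℕ → X}

/-- As both ratios tend to `1`, the upper end of `distInterval` tends to `arcosh 1 = 0`. -/
theorem isCauchySeq_of_tendsto_isoRatio (hρ : ∀ x, 1 < ρ x)
    (hd : ∀ x y, d x y ∈ distInterval (ρ x) (ρ y))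
    (hu : Tendsto (fun k => ρ (u k)) atTop (𝓝 1)) : IsCauchySeq d u := by
  intro ε hε
  have hcosh : 1 < Real.cosh (ε / 2) := Real.one_lt_cosh.2 (by positivity)
  -- With ratios below `1 + δ` the two square roots are at most `1 + δ` and `δ`, and `1 + 2δ = cosh
  -- (ε/2)`.
  set δ := (Real.cosh (ε / 2) - 1) / 2 with hδ
  have hδ0 : 0 < δ := by rw [hδ]; linarith
  obtain ⟨N, hN⟩ := eventually_atTop.1 (hu.eventually (gt_mem_nhds (show 1 < 1 + δ by linarith)))
  refine ⟨N, fun m n hm hn => ?_⟩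
  have h1 := hN m hm
  have h2 := hN n hn
  have h1' := hρ (u m)
  have h2' := hρ (u n)
  have e1 : √(ρ (u m) * ρ (u n)) ≤ 1 + δ := Real.sqrt_le_iff.2 ⟨by linarith, by nlinarith⟩
  have e2 : √((ρ (u m) - 1) * (ρ (u n) - 1)) ≤ δ :=
    Real.sqrt_le_iff.2 ⟨hδ0.le, by nlinarith⟩
  have e3 := sqrt_sub_one_lt h1' h2'
  have e4 := Real.sqrt_nonneg ((ρ (u m) - 1) * (ρ (u n) - 1))
  calc d (u m) (u n) ≤ _ := (hd _ _).2
    _ ≤ Real.arcosh (Real.cosh (ε / 2)) :=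
      (Real.arcosh_le_arcosh (by linarith) (by linarith)).2 (by linarith)
    _ = ε / 2 := Real.arcosh_cosh (by positivity)
    _ < ε := by linarith

/-- The argument of `arcosh` in the lower bound tends to `√(ρ x) > 1`, so the distances to `x`
eventually exceed a fixed positive number. -/
theorem not_convergesTo_of_tendsto_isoRatio (hρ : ∀ x, 1 < ρ x)
    (hd : ∀ x y, d x y ∈ distInterval (ρ x) (ρ y))
    (hu : Tendsto (fun k => ρ (u k)) atTop (𝓝 1)) (x : X) : ¬ ConvergesTo d u x := by
  intro h
  have hlim : Tendsto (fun k => √(ρ (u k) * ρ x) - √((ρ (u k) - 1) * (ρ x - 1))) atTop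
      (𝓝 (√(ρ x))) := by
    have := ((hu.mul_const (ρ x)).sqrt).sub (((hu.sub_const 1).mul_const (ρ x - 1)).sqrt)
    simpa using this
  have h1 : 1 < √(ρ x) := Real.lt_sqrt_of_sq_lt (by simpa using hρ x)
  obtain ⟨c, hc1, hc⟩ := exists_between h1
  have hpos := Real.arcosh_pos hc1
  obtain ⟨k, hk1, hk2⟩ := ((hlim.eventually (lt_mem_nhds hc)).and
    (h.eventually (gt_mem_nhds hpos))).exists
  have h2 := (hd (u k) x).1
  have h3 := (Real.arcosh_le_arcosh (by linarith) (by linarith)).2 hk1.le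
  linarith

end

theorem tendsto_isoRatio_unitBall :
    Tendsto (fun k : ℕ => isoRatio (unitBall (k + 2))) atTop (𝓝 1) := by
  have h : Tendsto (fun k : ℕ => 1 + 1 / ((k : ℝ) + 1)) atTop (𝓝 1) := by
    simpa using tendsto_one_div_add_atTop_nhds_zero_nat.const_add (1 : ℝ)
  exact tendsto_of_tendsto_of_tendsto_of_le_of_le tendsto_const_nhds h
    (fun k => (one_lt_isoRatio (area_unitBall_pos (Nat.le_add_left 2 k))).le)
    isoRatio_unitBall_le

end Shapes

end

theorem mainTheorem10 :
    (¬ Shapes.IsComplete Shapes.OShapeInf.dist ∧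
      Shapes.IsCauchySeq Shapes.OShapeInf.dist Shapes.oshapeBallSeq ∧
      ¬ ∃ x, Shapes.ConvergesTo Shapes.OShapeInf.dist Shapes.oshapeBallSeq x) ∧
    (¬ Shapes.IsComplete Shapes.ShapeInf.dist ∧
      Shapes.IsCauchySeq Shapes.ShapeInf.dist Shapes.shapeBallSeq ∧
      ¬ ∃ x, Shapes.ConvergesTo Shapes.ShapeInf.dist Shapes.shapeBallSeq x) := by
  -- The lifted ratio of the class of a ball reduces by definition to the ratio of the ball itself.
  have hO : Tendsto (fun k => Shapes.OShapeInf.isoRatio (Shapes.oshapeBallSeq k)) atTop (𝓝 1) :=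
    Shapes.tendsto_isoRatio_unitBall
  have hS : Tendsto (fun k => Shapes.ShapeInf.isoRatio (Shapes.shapeBallSeq k)) atTop (𝓝 1) :=
    Shapes.tendsto_isoRatio_unitBall
  have hOc := Shapes.isCauchySeq_of_tendsto_isoRatio Shapes.OShapeInf.one_lt_isoRatio
    Shapes.OShapeInf.dist_mem hO
  have hSc := Shapes.isCauchySeq_of_tendsto_isoRatio Shapes.ShapeInf.one_lt_isoRatio
    Shapes.ShapeInf.dist_mem hS
  have hOn : ¬ ∃ x, Shapes.ConvergesTo Shapes.OShapeInf.dist Shapes.oshapeBallSeq x :=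
    fun ⟨x, hx⟩ => Shapes.not_convergesTo_of_tendsto_isoRatio Shapes.OShapeInf.one_lt_isoRatio
      Shapes.OShapeInf.dist_mem hO x hx
  have hSn : ¬ ∃ x, Shapes.ConvergesTo Shapes.ShapeInf.dist Shapes.shapeBallSeq x :=
    fun ⟨x, hx⟩ => Shapes.not_convergesTo_of_tendsto_isoRatio Shapes.ShapeInf.one_lt_isoRatio
      Shapes.ShapeInf.dist_mem hS x hx
  exact ⟨⟨fun h => hOn (h _ hOc), hOc, hOn⟩, ⟨fun h => hSn (h _ hSc), hSc, hSn⟩⟩
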